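/- Let $N\ge 2$. Consider $N$ agents $$x_i(t+1)=Ax_i(t)+Bu_i(t)+d_i(t),\qquad y_i(t)=Cx_i(t)\in\mathbb R,\qquad d_i(t)=Ew_i(t),\qquad w_i(t+1)=Sw_i(t),$$ for $t=0,1,2,\dots$ and $i=1,\dots,N$, with real matrices of compatible sizes, states $x_i(t)\in\mathbb R^{n_x}$, inputs $u_i(t)\in\mathbb R^{n_u}$, disturbance states $w_i(t)\in\mathbb R^{n_w}$, and $(C,A,B)$ minimal (that is, $(A,B)$ controllable and $(C,A)$ observable). Let $f_i:\mathbb R\to\mathbb R$ be cost functions, and let $\mathcal G$ be a weighted digraph on $\{1,\dots,N\}$ with weights $a_{ij}\ge 0$, $a_{ii}=0$, where $a_{ij}>0$ means that agent $i$ receives information from agent $j$. Let $L=\mathrm{diag}\big(\sum_j a_{1j},\dots,\sum_j a_{Nj}\big)-(a_{ij})$ be its Laplacian, and let $\lambda_1\le\lambda_2\le\dots\le\lambda_N$ be the eigenvalues of $\tfrac12(L+L^\top)$. Assume: (i) there are constants $\underline l>0$ and $\bar l$ such that each $f_i$ is differentiable and $\underline l$-strongly convex, i.e. $(f_i'(a)-f_i'(b))(a-b)\ge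 \underline l\,|a-b|^2$ for all $a,b$, and $f_i'$ is $\bar l$-Lipschitz; (ii) $\mathcal G$ is strongly connected and weight-balanced, i.e. $\sum_j a_{ij}=\sum_j a_{ji}$ for all $i$; (iii) $X_1,X_2,U_1,U_2$ solve the regulator equations $X_1=AX_1+BU_1$, $1=CX_1$, $X_2S=AX_2+BU_2+E$, $0=CX_2$; (iv) the pair $\left([\,C\ \ 0\,],\begin{bmatrix}A&E\\0&S\end{bmatrix}\right)$ is observable. For gains $K,L_1,L_2$ and parameters $\alpha,\beta,\gamma$, put $K_1=U_1-KX_1$ and $K_2=U_2-KX_2$, and consider the controller with states $(\tilde x_i,\tilde w_i,z_i,\zeta_i)$ $$\begin{aligned}u_i(t)&=K\tilde x_i(t)+K_1z_i(t)+K_2\tilde w_i(t),\\ \tilde x_i(t+1)&=(A+L_1C)\tilde x_i(t)+Bu_i(t)+E\tilde w_i(t)-L_1y_i(t),\\ \tilde w_i(t+1)&=S\tilde w_i(t)+L_2\big(C\tilde x_i(t)-y_i(t)\big),\\ z_i(t+1)&=z_i(t)-\gamma\Big(\alpha f_i'(z_i(t))+\beta\sum_j a_{ij}(z_i(t)-z_j(t))+\sum_j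 a_{ij}(\zeta_i(t)-\zeta_j(t))\Big),\\ \zeta_i(t+1)&=\zeta_i(t)+\gamma\alpha\beta\sum_j a_{ij}(z_i(t)-z_j(t)).\end{aligned}$$ The design conditions are: $A+BK$ and $\begin{bmatrix}A+L_1C&E\\L_2C&S\end{bmatrix}$ are Schur stable (all eigenvalues have modulus $<1$), and $$\alpha\ge\max\Big\{1,\frac1{\underline l},\frac{2\bar l^2}{\underline l\lambda_2}\Big\},\qquad \beta\ge\max\Big\{1,\frac{4\alpha^2\lambda_N^2}{\lambda_2^2}\Big\},\qquad 0<\gamma<\frac1{\beta^4(\lambda_N^2+\bar l^2)}.$$ Then gains and parameters that satisfy the design conditions exist, and for every such choice the controller solves the optimal output consensus problem: it is distributed (agent $i$ uses only its own information and that of the agents $j$ with $a_{ij}>0$), the function $\sum_i f_i$ has a unique minimizer $y^*$, and for all initial states of the agents, the disturbances and the controllers, $\lim_{t\to\infty}|y_i(t)-y^*|=0$ for every $i$; moreover, for every $i$ whose disturbance $d_i$ is bounded, the trajectories $x_i,u_i,\tilde x_i,\tilde w_i,z_i,\zeta_i$ are bounded. -/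

import Mathlib

open Matrix Filter Topology

noncomputable section

namespace OptimalConsensus

/-! ### Weighted digraphs -/

/-- A weighted digraph on `N` nodes, given by its weighted adjacency matrix `(a_ij)`;
`a_ij > 0` means that there is an edge from `j` to `i`, i.e. that `i` receives information
from `j`. -/
structure WeightedDigraph (N : ℕ) where
  weight : Matrix (Fin N) (Fin N) ℝ
  weight_self : ∀ i, weight i i = 0
  weight_nonneg : ∀ i j, 0 ≤ weight i j

namespace WeightedDigraph

variable {N : ℕ} (G : WeightedDigraph N)

/-- There is an edge from `i` to `j`. -/
def Edge (i j : Fin N) : Prop := 0 < G.weight j i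

/-- Any node can be reached from any other node along a directed path. -/
def StronglyConnected : Prop := ∀ i j : Fin N, Relation.ReflTransGen G.Edge i j

def inDegree (i : Fin N) : ℝ := ∑ j, G.weight i j

def outDegree (i : Fin N) : ℝ := ∑ j, G.weight j i

def WeightBalanced : Prop := ∀ i, G.inDegree i = G.outDegree i

/-- The Laplacian `L = D^in - (a_ij)`. -/
def laplacian : Matrix (Fin N) (Fin N) ℝ := Matrix.diagonal G.inDegree - G.weight

/-- `Sym(L) = (L + Lᵀ) / 2`. -/
def symLaplacian : Matrix (Fin N) (Fin N) ℝ := (1 / 2 : ℝ) • (G.laplacian + G.laplacianᵀ)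

theorem symLaplacian_isHermitian : G.symLaplacian.IsHermitian := by
  ext i j
  simp [symLaplacian]
  ring

/-- The eigenvalues of `Sym(L)` with multiplicity, in increasing order
`eigenvalue 0 ≤ eigenvalue 1 ≤ … ≤ eigenvalue (N - 1)`. -/
def eigenvalue (k : Fin N) : ℝ :=
  G.symLaplacian_isHermitian.eigenvalues₀ (Fin.cast (Fintype.card_fin N).symm k.rev)

end WeightedDigraph

/-! ### Linear systems -/

/-- Schur stability: every complex eigenvalue lies in the open unit disc. -/
def IsSchur {n : Type*} [Fintype n] [DecidableEq n] (M : Matrix n n ℝ) : Prop :=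
  ∀ μ ∈ spectrum ℂ (M.map (algebraMap ℝ ℂ)), ‖μ‖ < 1

/-- Controllability of `(A, B)`: the matrix `[B, A B, …, A^(n-1) B]` has rank `n`. -/
def IsControllable {n m : Type*} [Fintype n] [DecidableEq n] [Fintype m]
    (A : Matrix n n ℝ) (B : Matrix n m ℝ) : Prop :=
  (Matrix.of fun (i : n) (p : Fin (Fintype.card n) × m) =>
    (A ^ (p.1 : ℕ) * B) i p.2).rank = Fintype.card n

/-- Observability of `(C, A)` for one output row `C`: the matrix with rows
`C, C A, …, C A^(n-1)` has rank `n`. -/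
def IsObservable {n : Type*} [Fintype n] [DecidableEq n]
    (C : n → ℝ) (A : Matrix n n ℝ) : Prop :=
  (Matrix.of fun (k : Fin (Fintype.card n)) => C ᵥ* A ^ (k : ℕ)).rank = Fintype.card n

/-- The data of one agent with its disturbance generator:
`x⁺ = A x + B u + d`, `y = C x`, `d = E w`, `w⁺ = S w`. The output is scalar, and the row
matrix `C` is stored as a vector. -/
structure AgentModel (nx nu nw : ℕ) where
  A : Matrix (Fin nx) (Fin nx) ℝ
  B : Matrix (Fin nx) (Fin nu) ℝ
  C : Fin nx → ℝ
  E : Matrix (Fin nx) (Fin nw) ℝ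
  S : Matrix (Fin nw) (Fin nw) ℝ

namespace AgentModel

variable {nx nu nw : ℕ} (M : AgentModel nx nu nw)

/-- `(C, A, B)` is a minimal realization. -/
def IsMinimal : Prop := IsControllable M.A M.B ∧ IsObservable M.C M.A

/-- The pair `([C 0], [A E; 0 S])` is observable. -/
def AugmentedObservable : Prop :=
  IsObservable (Sum.elim M.C (0 : Fin nw → ℝ)) (Matrix.fromBlocks M.A M.E 0 M.S)

/-- `(X₁, X₂, U₁, U₂)` solves the regulator equations. -/
def RegulatorEquations (X₁ : Fin nx → ℝ) (X₂ : Matrix (Fin nx) (Fin nw) ℝ)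
    (U₁ : Fin nu → ℝ) (U₂ : Matrix (Fin nu) (Fin nw) ℝ) : Prop :=
  X₁ = M.A *ᵥ X₁ + M.B *ᵥ U₁ ∧ 1 = M.C ⬝ᵥ X₁ ∧
    X₂ * M.S = M.A * X₂ + M.B * U₂ + M.E ∧ 0 = M.C ᵥ* X₂

end AgentModel

/-! ### Cost functions -/

/-- `f` is differentiable, `l`-strongly convex with `l > 0`, and has an `lbar`-Lipschitz
gradient. -/
def CostAssumption (l lbar : ℝ) (f : ℝ → ℝ) : Prop :=
  0 < l ∧ Differentiable ℝ f ∧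
    (∀ a b, l * |a - b| ^ 2 ≤ (deriv f a - deriv f b) * (a - b)) ∧
    (∀ a b, |deriv f a - deriv f b| ≤ lbar * |a - b|)

/-- `ystar` is the unique minimizer of the global cost `∑ f_i`. -/
def IsOptimalPoint {N : ℕ} (f : Fin N → ℝ → ℝ) (ystar : ℝ) : Prop :=
  ∀ s, s ≠ ystar → ∑ i, f i ystar < ∑ i, f i s

/-! ### Dynamic feedback controllers and the optimal output consensus problem -/

/-- A dynamic output feedback controller for `N` agents. The controller of agent `i` has a
state in `H`; its control input and its next state are computed from the family of
controller states and the family of measured outputs. -/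
structure DynamicController (N nu : ℕ) (H : Type) where
  input : Fin N → (Fin N → H) → (Fin N → ℝ) → (Fin nu → ℝ)
  update : Fin N → (Fin N → H) → (Fin N → ℝ) → H

/-- Agent `i` only uses its own information and that of its neighbors `j` (`a_ij > 0`). -/
def DynamicController.IsDistributed {N nu : ℕ} {H : Type} (ctrl : DynamicController N nu H)
    (G : WeightedDigraph N) : Prop :=
  ∀ (i : Fin N) (η η' : Fin N → H) (y y' : Fin N → ℝ),
    (∀ j, j = i ∨ G.Edge j i → η j = η' j ∧ y j = y' j) →
      ctrl.input i η y = ctrl.input i η' y' ∧ ctrl.update i η y = ctrl.update i η' y'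

/-- The outputs `y_i = C x_i` of all agents. -/
def outputs {N nx nu nw : ℕ} (M : AgentModel nx nu nw) (x : Fin N → Fin nx → ℝ) :
    Fin N → ℝ := fun i => M.C ⬝ᵥ x i

/-- `x`, `w`, `η` (agent states, disturbance states, controller states) form a trajectory of
the closed loop of the agents with the controller. The initial states are arbitrary. -/
structure IsClosedLoopTrajectory {N nx nu nw : ℕ} {H : Type} (M : AgentModel nx nu nw)
    (ctrl : DynamicController N nu H) (x : ℕ → Fin N → Fin nx → ℝ)
    (w : ℕ → Fin N → Fin nw → ℝ) (η : ℕ → Fin N → H) : Prop where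
  state : ∀ t i, x (t + 1) i =
    M.A *ᵥ x t i + M.B *ᵥ ctrl.input i (η t) (outputs M (x t)) + M.E *ᵥ w t i
  disturbance : ∀ t i, w (t + 1) i = M.S *ᵥ w t i
  controller : ∀ t i, η (t + 1) i = ctrl.update i (η t) (outputs M (x t))

/-- The controller solves the optimal output consensus problem: it is distributed, the global
cost has a unique minimizer `ystar`, and along every closed-loop trajectory all outputs
converge to `ystar`, while the state, the input and the controller state of every agent
whose disturbance `d_i = E w_i` is bounded stay bounded. -/
def SolvesOptimalOutputConsensus {N nx nu nw : ℕ} {H : Type} [Bornology H]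
    (M : AgentModel nx nu nw) (f : Fin N → ℝ → ℝ) (G : WeightedDigraph N)
    (ctrl : DynamicController N nu H) : Prop :=
  ctrl.IsDistributed G ∧
  ∃ ystar : ℝ, IsOptimalPoint f ystar ∧
    ∀ (x : ℕ → Fin N → Fin nx → ℝ) (w : ℕ → Fin N → Fin nw → ℝ) (η : ℕ → Fin N → H),
      IsClosedLoopTrajectory M ctrl x w η →
        (∀ i, Tendsto (fun t => |outputs M (x t) i - ystar|) atTop (𝓝 0)) ∧
        (∀ i, Bornology.IsBounded (Set.range fun t => M.E *ᵥ w t i) →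
          Bornology.IsBounded (Set.range fun t => x t i) ∧
          Bornology.IsBounded
            (Set.range fun t => ctrl.input i (η t) (outputs M (x t))) ∧
          Bornology.IsBounded (Set.range fun t => η t i))

/-! ### The proposed controller -/

/-- The tunable gains and step sizes. -/
structure Gains (nx nu nw : ℕ) where
  K : Matrix (Fin nu) (Fin nx) ℝ
  L₁ : Fin nx → ℝ
  L₂ : Fin nw → ℝ
  α : ℝ
  β : ℝ
  γ : ℝ

/-- The design conditions for `K`, `L₁`, `L₂`: the matrices `A + B K` and
`[A + L₁ C, E; L₂ C, S]` are Schur stable. -/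
def Gains.StabilizingFor {nx nu nw : ℕ} (g : Gains nx nu nw) (M : AgentModel nx nu nw) :
    Prop :=
  IsSchur (M.A + M.B * g.K) ∧
  IsSchur (Matrix.fromBlocks (M.A + vecMulVec g.L₁ M.C) M.E (vecMulVec g.L₂ M.C) M.S)

/-- The design conditions for `α`, `β`, `γ`, where `lam2` and `lamN` stand for the second
smallest and the largest eigenvalue of `Sym(L)`. -/
def Gains.StepSizesFor {nx nu nw : ℕ} (g : Gains nx nu nw) (l lbar lam2 lamN : ℝ) : Prop :=
  max 1 (max (1 / l) (2 * lbar ^ 2 / (l * lam2))) ≤ g.α ∧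
  max 1 (4 * g.α ^ 2 * lamN ^ 2 / lam2 ^ 2) ≤ g.β ∧
  0 < g.γ ∧ g.γ < 1 / (g.β ^ 4 * (lamN ^ 2 + lbar ^ 2))

/-- The state `(xhat, what, z, lam)` of the controller of one agent. -/
abbrev CtrlState (nx nw : ℕ) : Type := (Fin nx → ℝ) × (Fin nw → ℝ) × ℝ × ℝ

namespace CtrlState

variable {nx nw : ℕ} (η : CtrlState nx nw)

/-- Estimate of the agent state. -/
def xhat : Fin nx → ℝ := η.1

/-- Estimate of the disturbance state. -/
def what : Fin nw → ℝ := η.2.1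

/-- Primal variable of the optimal signal generator. -/
def z : ℝ := η.2.2.1

/-- Dual variable of the optimal signal generator. -/
def lam : ℝ := η.2.2.2

end CtrlState

/-- The control input `u = K xhat + K₁ z + K₂ what` with `K₁ = U₁ - K X₁`,
`K₂ = U₂ - K X₂`. -/
def fullInput {nx nu nw : ℕ} (K : Matrix (Fin nu) (Fin nx) ℝ) (X₁ : Fin nx → ℝ)
    (X₂ : Matrix (Fin nx) (Fin nw) ℝ) (U₁ : Fin nu → ℝ) (U₂ : Matrix (Fin nu) (Fin nw) ℝ)
    (η : CtrlState nx nw) : Fin nu → ℝ :=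
  K *ᵥ η.xhat + η.z • (U₁ - K *ᵥ X₁) + (U₂ - K * X₂) *ᵥ η.what

/-- The proposed controller: regulator-equation feedback, Luenberger observer and primal-dual
optimal signal generator. -/
def fullController {N nx nu nw : ℕ} (M : AgentModel nx nu nw) (f : Fin N → ℝ → ℝ)
    (G : WeightedDigraph N) (X₁ : Fin nx → ℝ) (X₂ : Matrix (Fin nx) (Fin nw) ℝ)
    (U₁ : Fin nu → ℝ) (U₂ : Matrix (Fin nu) (Fin nw) ℝ) (g : Gains nx nu nw) :
    DynamicController N nu (CtrlState nx nw) where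
  input i η _ := fullInput g.K X₁ X₂ U₁ U₂ (η i)
  update i η y :=
    ((M.A + vecMulVec g.L₁ M.C) *ᵥ (η i).xhat
        + M.B *ᵥ fullInput g.K X₁ X₂ U₁ U₂ (η i)
        + M.E *ᵥ (η i).what - y i • g.L₁,
      M.S *ᵥ (η i).what + (M.C ⬝ᵥ (η i).xhat - y i) • g.L₂,
      (η i).z - g.γ * (g.α * deriv (f i) (η i).z
        + g.β * (G.laplacian *ᵥ fun j => (η j).z) i + (G.laplacian *ᵥ fun j => (η j).lam) i),
      (η i).lam + g.γ * g.α * g.β * (G.laplacian *ᵥ fun j => (η j).z) i)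

end OptimalConsensus

end

/-! The closed loop is a cascade. The signal generator `(z, ζ)` runs on its own, and the observer
error obeys an autonomous Schur recursion. The tracking error `x - z • X₁ - X₂ *ᵥ w` is propagated
by `A + B K` and driven only by the observer error and the increments of `z`. Both inputs vanish
once `z` converges, so the tracking error vanishes by `IsSchur.tendsto_zero`. Since `C X₁ = 1` and
`C X₂ = 0`, this gives `y_i - z_i → 0` even when `w` is unbounded.

The core is therefore `optimalSignalGenerator_tendsto`. An equilibrium needs `L ζs = -α ∇f(y*)`,
which is solvable because the gradients at `y*` sum to zero. With `δ = z - y*`, the coordinate `y =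
ζ - ζs + c δ`, where `c ^ 2 - β c + α β = 0`, removes `L δ` from the recursion of `y`, so the linear
part becomes block triangular. Let `Y` be the mean-free part of `y`. Then `κ |Y|² + |δ|²` contracts
geometrically (`lyapunov_decrease`, `step_size_bounds`): `λ₂` on mean-free vectors and strong
monotonicity give dissipation, completed squares absorb the cross terms, and the terms in `γ ^ 2`
are small. As `L` need not be symmetric, `|L x|²` is controlled by `2 λ_N (x ⬝ᵥ L x)`, from
Cauchy–Schwarz and the bound of the in-degrees by `λ_N`.

Stabilizing gains exist because a controllable pair admits a feedback that makes the closed loop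
nilpotent; observer gains follow by duality. For boundedness, observability recovers `w` linearly
from a finite window of the values `E w`. -/

noncomputable section

namespace OptimalConsensus

/-! ### Deadbeat feedback -/

section Deadbeat

variable {k V U : Type*} [Field k] [AddCommGroup V] [Module k V] [AddCommGroup U] [Module k U]

/-- The subspace of the states reachable from the origin in a given number of steps. -/
def reachable (a : V →ₗ[k] V) (b : U →ₗ[k] V) : ℕ → Submodule k V
  | 0 => ⊥
  | t + 1 => reachable a b t ⊔ LinearMap.range ((a ^ t) ∘ₗ b)

/-- The subspace of the states that can be steered to the origin in a given number of steps. -/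
def nullControllable (a : V →ₗ[k] V) (b : U →ₗ[k] V) (t : ℕ) : Submodule k V :=
  (reachable a b t).comap (a ^ t)

theorem reachable_mono (a : V →ₗ[k] V) (b : U →ₗ[k] V) : Monotone (reachable a b) :=
  monotone_nat_of_le_succ fun _ => le_sup_left

theorem map_reachable_le (a : V →ₗ[k] V) (b : U →ₗ[k] V) (t : ℕ) {x : V}
    (hx : x ∈ reachable a b t) : a x ∈ reachable a b (t + 1) := by
  induction t generalizing x with
  | zero =>
    have : x = 0 := by simpa [reachable] using hx
    simp [this]
  | succ t ih =>
    obtain ⟨r, hr, s, ⟨u, rfl⟩, rfl⟩ := Submodule.mem_sup.1 hx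
    rw [map_add]
    refine Submodule.add_mem_sup (ih hr) ⟨u, ?_⟩
    simp [pow_succ']

/-- The dynamic programming step: the component of `a ^ (t + 1) x` in the range of `a ^ t ∘ₗ b` is
cancelled by the first input, whence the sign `-u`. -/
theorem mem_nullControllable_succ {a : V →ₗ[k] V} {b : U →ₗ[k] V} {t : ℕ} {x : V} :
    x ∈ nullControllable a b (t + 1) ↔ ∃ u, a x + b u ∈ nullControllable a b t := by
  simp only [nullControllable, Submodule.mem_comap, reachable, pow_succ, Module.End.mul_apply,
    map_add]
  constructor
  · intro h
    obtain ⟨r, hr, s, ⟨u, rfl⟩, h⟩ := Submodule.mem_sup.1 h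
    refine ⟨-u, ?_⟩
    rw [← h]
    simpa using hr
  · rintro ⟨u, hu⟩
    refine Submodule.mem_sup.2 ⟨_, hu, _, ⟨-u, rfl⟩, ?_⟩
    simp

theorem nullControllable_le_succ (a : V →ₗ[k] V) (b : U →ₗ[k] V) (t : ℕ) :
    nullControllable a b t ≤ nullControllable a b (t + 1) := by
  intro x hx
  simp only [nullControllable, Submodule.mem_comap, pow_succ', Module.End.mul_apply] at hx ⊢
  exact map_reachable_le a b t hx

theorem nullControllable_mono (a : V →ₗ[k] V) (b : U →ₗ[k] V) :
    Monotone (nullControllable a b) :=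
  monotone_nat_of_le_succ (nullControllable_le_succ a b)

/-- The admissible pairs `(x, u)` form a subspace, so a linear section of its projection to `x`
chooses the input linearly in the state. -/
theorem exists_feedback_step (a : V →ₗ[k] V) (b : U →ₗ[k] V) (t : ℕ) :
    ∃ s : V →ₗ[k] U, ∀ x ∈ nullControllable a b (t + 1),
      a x + b (s x) ∈ nullControllable a b t := by
  let W : Submodule k (V × U) := (nullControllable a b t).comap (a.coprod b)
  let p : W →ₗ[k] V := LinearMap.fst k V U ∘ₗ W.subtype
  obtain ⟨g, hg⟩ := p.rangeRestrict.exists_rightInverse_of_surjective p.range_rangeRestrict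
  obtain ⟨s, hs⟩ := LinearMap.exists_extend (LinearMap.snd k V U ∘ₗ W.subtype ∘ₗ g)
  refine ⟨s, fun x hx => ?_⟩
  obtain ⟨u, hu⟩ := mem_nullControllable_succ.1 hx
  have hxr : x ∈ LinearMap.range p := ⟨⟨(x, u), by simpa [W] using hu⟩, rfl⟩
  have h1 : s x = ((g ⟨x, hxr⟩ : W) : V × U).2 := LinearMap.congr_fun hs ⟨x, hxr⟩
  have h2 : ((g ⟨x, hxr⟩ : W) : V × U).1 = x :=
    congrArg Subtype.val (LinearMap.congr_fun hg ⟨x, hxr⟩)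
  have h3 : a.coprod b (g ⟨x, hxr⟩ : W) ∈ nullControllable a b t := (g ⟨x, hxr⟩).2
  rwa [LinearMap.coprod_apply, h2, ← h1] at h3

/-- One feedback must descend the whole flag of null-controllable subspaces. The induction keeps the
old feedback on the subspace of level `t`, through a projection `P'`, and applies the new step only
to the complementary part `x - P' x`. -/
theorem exists_deadbeat_feedback (a : V →ₗ[k] V) (b : U →ₗ[k] V) (t : ℕ) :
    ∃ K : V →ₗ[k] U, ∀ j < t, ∀ x ∈ nullControllable a b (j + 1),
      a x + b (K x) ∈ nullControllable a b j := by
  induction t with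
  | zero => exact ⟨0, by simp⟩
  | succ t ih =>
    obtain ⟨K, hK⟩ := ih
    obtain ⟨s, hs⟩ := exists_feedback_step a b t
    obtain ⟨P, hP⟩ := (nullControllable a b t).subtype.exists_leftInverse_of_injective
      (Submodule.ker_subtype _)
    let P' : V →ₗ[k] V := (nullControllable a b t).subtype ∘ₗ P
    have hfix : ∀ x ∈ nullControllable a b t, P' x = x := fun x hx =>
      congrArg Subtype.val (LinearMap.congr_fun hP ⟨x, hx⟩)
    have hmem : ∀ x, P' x ∈ nullControllable a b t := fun x => (P x).2
    refine ⟨K ∘ₗ P' + s ∘ₗ (LinearMap.id - P'), fun j hj x hx => ?_⟩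
    rcases Nat.lt_succ_iff_lt_or_eq.1 hj with hj | rfl
    · simpa [hfix x (nullControllable_mono a b hj hx)] using hK j hj x hx
    · have h1 := hs (x - P' x) (sub_mem hx (nullControllable_le_succ a b j (hmem x)))
      have h2 : a (P' x) + b (K (P' x)) ∈ nullControllable a b j := by
        rcases j with _ | j
        · have h0 : P' x = 0 := by simpa [nullControllable, reachable] using hmem x
          simp [h0]
        · exact nullControllable_le_succ a b j (hK j (Nat.lt_succ_self j) _ (hmem x))
      have h3 := add_mem h1 h2
      have h4 : a x + b ((K ∘ₗ P' + s ∘ₗ (LinearMap.id - P') : V →ₗ[k] U) x) =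
          a (x - P' x) + b (s (x - P' x)) + (a (P' x) + b (K (P' x))) := by
        simp only [LinearMap.add_apply, LinearMap.comp_apply, LinearMap.sub_apply,
          LinearMap.id_apply, map_sub, map_add]
        abel
      rwa [h4]

theorem exists_nilpotent_feedback (a : V →ₗ[k] V) (b : U →ₗ[k] V) {t : ℕ}
    (h : reachable a b t = ⊤) : ∃ K : V →ₗ[k] U, (a + b ∘ₗ K) ^ t = 0 := by
  obtain ⟨K, hK⟩ := exists_deadbeat_feedback a b t
  refine ⟨K, ?_⟩
  have key : ∀ j ≤ t, ∀ x ∈ nullControllable a b j, ((a + b ∘ₗ K) ^ j) x = 0 := by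
    intro j
    induction j with
    | zero => intro _ x hx; simpa [nullControllable, reachable] using hx
    | succ j ih =>
      intro hj x hx
      rw [pow_succ, Module.End.mul_apply]
      exact ih (by omega) _ (hK j hj x hx)
  ext x
  exact key t le_rfl x (by simp [nullControllable, h])

end Deadbeat

/-! ### Stabilizing feedback and observer gains for matrices -/

section Gains

variable {n m : Type*} [Fintype n] [DecidableEq n] [Fintype m]

theorem IsControllable.reachable_eq_top {A : Matrix n n ℝ} {B : Matrix n m ℝ}
    (h : IsControllable A B) :
    reachable A.mulVecLin B.mulVecLin (Fintype.card n) = ⊤ := by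
  classical
  unfold IsControllable at h
  set T : Matrix n (Fin (Fintype.card n) × m) ℝ :=
    Matrix.of fun (i : n) (p : Fin (Fintype.card n) × m) => (A ^ (p.1 : ℕ) * B) i p.2 with hT
  have htop : LinearMap.range T.mulVecLin = ⊤ := by
    apply Submodule.eq_top_of_finrank_eq
    rw [Module.finrank_fintype_fun_eq_card]
    exact h
  rw [eq_top_iff, ← htop, Matrix.range_mulVecLin, Submodule.span_le]
  rintro _ ⟨⟨i, j⟩, rfl⟩
  refine reachable_mono _ _ i.2 ?_
  refine Submodule.mem_sup_right ⟨Pi.single j 1, ?_⟩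
  have hpow : ∀ (t : ℕ) (v : n → ℝ), (A.mulVecLin ^ t) v = A ^ t *ᵥ v := by
    intro t
    induction t with
    | zero => simp
    | succ t ih => intro v; rw [pow_succ, Module.End.mul_apply, ih, pow_succ]; simp
  rw [LinearMap.comp_apply, hpow, Matrix.mulVecLin_apply, Matrix.mulVec_mulVec,
    Matrix.mulVec_single_one]
  rfl

theorem isSchur_of_pow_eq_zero {A : Matrix n n ℝ} {t : ℕ} (h : A ^ t = 0) : IsSchur A := by
  intro μ hμ
  have h0 : (A.map (algebraMap ℝ ℂ)) ^ t = 0 := by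
    rw [← Matrix.map_pow, h]; simp
  have := spectrum.pow_mem_pow (A.map (algebraMap ℝ ℂ)) t hμ
  rw [h0] at this
  rcases isEmpty_or_nonempty n with hn | hn
  · rw [spectrum.of_subsingleton] at hμ
    exact hμ.elim
  · rw [spectrum.zero_eq, Set.mem_singleton_iff] at this
    rw [eq_zero_of_pow_eq_zero this]
    simp

theorem IsControllable.exists_isSchur {A : Matrix n n ℝ} {B : Matrix n m ℝ}
    (h : IsControllable A B) : ∃ K : Matrix m n ℝ, IsSchur (A + B * K) := by
  obtain ⟨K, hK⟩ := exists_nilpotent_feedback _ _ h.reachable_eq_top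
  refine ⟨LinearMap.toMatrix' K, isSchur_of_pow_eq_zero (t := Fintype.card n) ?_⟩
  apply (Matrix.toLinAlgEquiv' : Matrix n n ℝ ≃ₐ[ℝ] _).injective
  rw [map_pow, map_zero, ← hK]
  congr 1
  refine LinearMap.ext fun v => ?_
  simp only [LinearMap.comp_apply, LinearMap.add_apply, Matrix.toLinAlgEquiv'_apply,
    Matrix.mulVecLin_apply, Matrix.add_mulVec, ← Matrix.mulVec_mulVec, LinearMap.toMatrix'_mulVec]

/-- Duality: observability is controllability of the transposed pair, and transposition preserves
the spectrum. -/
theorem IsObservable.exists_isSchur {A : Matrix n n ℝ} {C : n → ℝ}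
    (h : IsObservable C A) : ∃ L : n → ℝ, IsSchur (A + vecMulVec L C) := by
  have hc : IsControllable Aᵀ (Matrix.replicateCol Unit C) := by
    unfold IsControllable
    unfold IsObservable at h
    rw [← Matrix.rank_transpose] at h
    refine (Eq.trans ?_ h)
    rw [← Matrix.rank_submatrix _ (Equiv.refl n) (Equiv.prodUnique (Fin (Fintype.card n)) Unit)]
    congr 1
    ext i p
    simp [← Matrix.transpose_pow, Matrix.mul_apply, Matrix.vecMul, dotProduct, mul_comm]
  obtain ⟨K, hK⟩ := hc.exists_isSchur
  refine ⟨K (), ?_⟩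
  intro μ hμ
  apply hK
  have : Aᵀ + Matrix.replicateCol Unit C * K = (A + vecMulVec (K ()) C)ᵀ := by
    ext i j
    simp [Matrix.mul_apply, vecMulVec_apply, mul_comm]
  rw [this, Matrix.transpose_map, spectrum.mem_iff]
  rw [spectrum.mem_iff] at hμ
  intro hu
  apply hμ
  rw [← Matrix.isUnit_transpose]
  convert hu using 1
  ext i j
  simp [Matrix.algebraMap_matrix_apply, eq_comm]

end Gains

/-! ### Schur stable systems with vanishing input -/

section Stability

attribute [local instance] Matrix.linftyOpNormedRing Matrix.linftyOpNormedAlgebra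

variable {n : Type*} [Fintype n] [DecidableEq n]

/-- Gelfand's formula bounds `‖a ^ t‖` by `q ^ t` for large `t`, with `q < 1` above the spectral
radius. -/
theorem exists_norm_pow_lt_of_spectralRadius_lt_one {R : Type*} [NormedRing R] [CompleteSpace R]
    [NormedAlgebra ℂ R] {a : R} (h : spectralRadius ℂ a < 1) {ε : ℝ} (hε : 0 < ε) :
    ∃ t : ℕ, 0 < t ∧ ‖a ^ t‖ < ε := by
  obtain ⟨q, hq, hq1⟩ := exists_between h
  lift q to NNReal using hq1.ne_top
  have hq1' : (q : ℝ) < 1 := by exact_mod_cast hq1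
  have h1 := (spectrum.pow_nnnorm_pow_one_div_tendsto_nhds_spectralRadius a).eventually_lt_const hq
  have h2 := (tendsto_pow_atTop_nhds_zero_of_lt_one q.2 hq1').eventually_lt_const hε
  obtain ⟨t, ⟨ht1, ht2⟩, ht⟩ := ((h1.and h2).and (eventually_gt_atTop 0)).exists
  refine ⟨t, ht, lt_of_le_of_lt ?_ ht2⟩
  have ht' : (0 : ℝ) < t := by exact_mod_cast ht
  have h3 := ENNReal.rpow_le_rpow ht1.le ht'.le
  rw [← ENNReal.rpow_mul, one_div_mul_cancel ht'.ne', ENNReal.rpow_one, ENNReal.rpow_natCast] at h3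
  exact_mod_cast h3

theorem IsSchur.exists_contracting_pow [Nonempty n] {A : Matrix n n ℝ} (h : IsSchur A) :
    ∃ t : ℕ, 0 < t ∧ ∀ v : n → ℝ, ‖A ^ t *ᵥ v‖ ≤ 1 / 2 * ‖v‖ := by
  have hr : spectralRadius ℂ (A.map (algebraMap ℝ ℂ)) < ((1 : NNReal) : ENNReal) :=
    spectrum.spectralRadius_lt_of_forall_lt _ fun μ hμ => by
      have := h μ hμ
      exact_mod_cast this
  obtain ⟨t, ht, hlt⟩ := exists_norm_pow_lt_of_spectralRadius_lt_one hr (ε := 1 / 2) (by norm_num)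
  refine ⟨t, ht, fun v => ?_⟩
  -- The maximal row sum norm sees only absolute values of entries, so complexification does not
  -- change it.
  have hnorm : ‖A ^ t‖ = ‖(A.map (algebraMap ℝ ℂ)) ^ t‖ := by
    rw [← Matrix.map_pow, Matrix.linfty_opNorm_def, Matrix.linfty_opNorm_def]
    simp
  refine (Matrix.linfty_opNorm_mulVec _ _).trans ?_
  rw [hnorm]
  gcongr

end Stability

theorem tendsto_zero_of_le_half_mul_add {a ρ : ℕ → ℝ} {m : ℕ} (hm : 0 < m) (ha : ∀ t, 0 ≤ a t)
    (hρ : Tendsto ρ atTop (𝓝 0)) (h : ∀ t, a (t + m) ≤ 1 / 2 * a t + ρ t) :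
    Tendsto a atTop (𝓝 0) := by
  rw [Metric.tendsto_atTop]
  intro ε hε
  obtain ⟨T, hT⟩ := eventually_atTop.1 (hρ.eventually_le_const (show (0 : ℝ) < ε / 4 by linarith))
  obtain ⟨D, hD⟩ : ∃ D, ∀ r < m, a (T + r) ≤ D :=
    ⟨∑ r ∈ Finset.range m, a (T + r), fun r hr =>
      Finset.single_le_sum (f := fun r => a (T + r)) (fun i _ => ha _) (Finset.mem_range.2 hr)⟩
  -- The recursion is followed along each residue class modulo `m`; `ε / 2` is the fixed point of `s
  -- ↦ s / 2 + ε / 4`.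
  have hind : ∀ r < m, ∀ q, a (T + r + q * m) ≤ (1 / 2) ^ q * D + ε / 2 := by
    intro r hr q
    induction q with
    | zero => simpa using (hD r hr).trans (by linarith)
    | succ q ih =>
      have h1 := h (T + r + q * m)
      have h2 := hT (T + r + q * m) (by omega)
      rw [show T + r + (q + 1) * m = T + r + q * m + m by ring, pow_succ]
      linarith
  have hlim : Tendsto (fun q : ℕ => ((1 : ℝ) / 2) ^ q * D) atTop (𝓝 0) := by
    simpa using (tendsto_pow_atTop_nhds_zero_of_lt_one (r := (1 : ℝ) / 2) (by norm_num)
      (by norm_num)).mul_const D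
  obtain ⟨Q, hQ⟩ := eventually_atTop.1 (hlim.eventually_lt_const (half_pos hε))
  refine ⟨T + Q * m, fun t ht => ?_⟩
  have hdiv := Nat.mod_add_div' (t - T) m
  have hq : Q ≤ (t - T) / m := (Nat.le_div_iff_mul_le hm).2 (by omega)
  have h1 := hind ((t - T) % m) (Nat.mod_lt _ hm) ((t - T) / m)
  rw [show T + (t - T) % m + (t - T) / m * m = t by omega] at h1
  have h2 := hQ _ hq
  rw [Real.dist_eq, sub_zero, abs_of_nonneg (ha t)]
  linarith

theorem tendsto_mulVec_zero {m n : Type*} [Fintype n] (A : Matrix m n ℝ) {e : ℕ → n → ℝ}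
    (he : Tendsto e atTop (𝓝 0)) : Tendsto (fun t => A *ᵥ e t) atTop (𝓝 0) := by
  have h : Continuous fun v : n → ℝ => A *ᵥ v := continuous_const.matrix_mulVec continuous_id
  simpa [Function.comp_def] using (h.tendsto 0).comp he

/-- Over `m` steps the homogeneous part halves the norm, while the accumulated input is a finite sum
of vanishing terms. -/
theorem IsSchur.tendsto_zero {n : Type*} [Fintype n] [DecidableEq n] [Nonempty n]
    {A : Matrix n n ℝ} (h : IsSchur A) {e r : ℕ → n → ℝ}
    (hr : Tendsto r atTop (𝓝 0)) (he : ∀ t, e (t + 1) = A *ᵥ e t + r t) :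
    Tendsto e atTop (𝓝 0) := by
  obtain ⟨m, hm, hA⟩ := h.exists_contracting_pow
  have hstep : ∀ k, ∃ ρ : ℕ → n → ℝ, Tendsto ρ atTop (𝓝 0) ∧
      ∀ t, e (t + k) = A ^ k *ᵥ e t + ρ t := by
    intro k
    induction k with
    | zero => exact ⟨0, tendsto_const_nhds, by simp⟩
    | succ k ih =>
      obtain ⟨ρ, hρ, hk⟩ := ih
      refine ⟨fun t => A *ᵥ ρ t + r (t + k), ?_, fun t => ?_⟩
      · simpa using (tendsto_mulVec_zero A hρ).add (hr.comp (tendsto_add_atTop_nat k))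
      · rw [← add_assoc, he, hk, Matrix.mulVec_add, Matrix.mulVec_mulVec, ← pow_succ', add_assoc]
  obtain ⟨ρ, hρ, hk⟩ := hstep m
  rw [tendsto_zero_iff_norm_tendsto_zero] at hρ ⊢
  refine tendsto_zero_of_le_half_mul_add hm (fun t => norm_nonneg _) hρ fun t => ?_
  rw [hk]
  exact (norm_add_le _ _).trans (by gcongr; exact hA _)

/-! ### Laplacians of weight-balanced digraphs -/

namespace WeightedDigraph

variable {N : ℕ} (G : WeightedDigraph N)

theorem laplacian_mulVec_apply (x : Fin N → ℝ) (i : Fin N) :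
    (G.laplacian *ᵥ x) i = ∑ j, G.weight i j * (x i - x j) := by
  rw [laplacian, Matrix.sub_mulVec, Pi.sub_apply, Matrix.mulVec_diagonal]
  simp only [inDegree, Matrix.mulVec, dotProduct, mul_sub, Finset.sum_sub_distrib, Finset.sum_mul]

theorem laplacian_mulVec_const (s : ℝ) : (G.laplacian *ᵥ fun _ => s) = 0 := by
  ext i
  simp [laplacian_mulVec_apply]

variable {G}

theorem WeightBalanced.transpose_laplacian_mulVec_apply (hbal : G.WeightBalanced)
    (x : Fin N → ℝ) (i : Fin N) :
    (G.laplacianᵀ *ᵥ x) i = ∑ j, G.weight j i * (x i - x j) := by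
  have := hbal i
  simp only [inDegree, outDegree] at this
  rw [laplacian, Matrix.transpose_sub, Matrix.diagonal_transpose, Matrix.sub_mulVec, Pi.sub_apply,
    Matrix.mulVec_diagonal]
  simp only [inDegree, this, Matrix.mulVec, dotProduct, mul_sub, Finset.sum_sub_distrib,
    Finset.sum_mul, Matrix.transpose_apply]

theorem WeightBalanced.sum_laplacian_mulVec (hbal : G.WeightBalanced) (x : Fin N → ℝ) :
    ∑ i, (G.laplacian *ᵥ x) i = 0 := by
  have h1 : ∑ i, (G.laplacian *ᵥ x) i = (fun _ => (1 : ℝ)) ⬝ᵥ (G.laplacian *ᵥ x) := by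
    simp [dotProduct]
  rw [h1, Matrix.dotProduct_mulVec, ← Matrix.mulVec_transpose]
  have h2 : (G.laplacianᵀ *ᵥ fun _ => (1 : ℝ)) = 0 := by
    ext i
    simp [hbal.transpose_laplacian_mulVec_apply]
  rw [h2, zero_dotProduct]

/-- Balance makes the sums of `a_ij x_i ^ 2` and `a_ij x_j ^ 2` equal, which completes the square
without symmetry of the weights. -/
theorem WeightBalanced.dotProduct_laplacian_mulVec (hbal : G.WeightBalanced) (x : Fin N → ℝ) :
    x ⬝ᵥ (G.laplacian *ᵥ x) = 1 / 2 * ∑ i, ∑ j, G.weight i j * (x i - x j) ^ 2 := by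
  have h1 : ∑ i, ∑ j, G.weight i j * x i ^ 2 = ∑ i, ∑ j, G.weight i j * x j ^ 2 := by
    rw [Finset.sum_comm (f := fun i j => G.weight i j * x j ^ 2)]
    refine Finset.sum_congr rfl fun i _ => ?_
    have := hbal i
    simp only [inDegree, outDegree] at this
    rw [← Finset.sum_mul, this, Finset.sum_mul]
  have h2 : x ⬝ᵥ (G.laplacian *ᵥ x) =
      ∑ i, ∑ j, (G.weight i j * x i ^ 2 - G.weight i j * (x i * x j)) := by
    simp only [dotProduct, laplacian_mulVec_apply, Finset.mul_sum]
    refine Finset.sum_congr rfl fun i _ => Finset.sum_congr rfl fun j _ => ?_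
    ring
  have h3 : ∑ i, ∑ j, G.weight i j * (x i - x j) ^ 2 =
      ∑ i, ∑ j, (G.weight i j * x i ^ 2 + G.weight i j * x j ^ 2
        - 2 * (G.weight i j * (x i * x j))) := by
    refine Finset.sum_congr rfl fun i _ => Finset.sum_congr rfl fun j _ => ?_
    ring
  rw [h2, h3]
  simp only [Finset.sum_sub_distrib, Finset.sum_add_distrib, ← Finset.mul_sum]
  rw [← h1]
  ring

theorem WeightBalanced.dotProduct_laplacian_mulVec_nonneg (hbal : G.WeightBalanced)
    (x : Fin N → ℝ) : 0 ≤ x ⬝ᵥ (G.laplacian *ᵥ x) := by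
  rw [hbal.dotProduct_laplacian_mulVec]
  have := fun i j => mul_nonneg (G.weight_nonneg i j) (sq_nonneg (x i - x j))
  have := Finset.sum_nonneg fun i (_ : i ∈ Finset.univ) =>
    Finset.sum_nonneg fun j (_ : j ∈ Finset.univ) => this i j
  linarith

theorem StronglyConnected.eq_of_dotProduct_laplacian_mulVec_le_zero
    (hconn : G.StronglyConnected) (hbal : G.WeightBalanced) {x : Fin N → ℝ}
    (hx : x ⬝ᵥ (G.laplacian *ᵥ x) ≤ 0) (i j : Fin N) : x i = x j := by
  have hnn : ∀ i j, 0 ≤ G.weight i j * (x i - x j) ^ 2 := fun i j =>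
    mul_nonneg (G.weight_nonneg i j) (sq_nonneg (x i - x j))
  have hnn' : ∀ i, 0 ≤ ∑ j, G.weight i j * (x i - x j) ^ 2 := fun i =>
    Finset.sum_nonneg fun j _ => hnn i j
  have hzero : ∑ i, ∑ j, G.weight i j * (x i - x j) ^ 2 = 0 := by
    rw [hbal.dotProduct_laplacian_mulVec] at hx
    refine le_antisymm (by linarith) (Finset.sum_nonneg fun i _ => hnn' i)
  have hedge : ∀ i j, G.Edge i j → x i = x j := by
    intro i j hij
    have h1 := (Finset.sum_eq_zero_iff_of_nonneg fun i _ => hnn' i).1 hzero j (Finset.mem_univ _)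
    have h2 := (Finset.sum_eq_zero_iff_of_nonneg fun i _ => hnn j i).1 h1 i (Finset.mem_univ _)
    rcases mul_eq_zero.1 h2 with h | h
    · exact absurd h (ne_of_gt hij)
    · exact (sub_eq_zero.1 (pow_eq_zero_iff two_ne_zero |>.1 h)).symm
  induction hconn i j with
  | refl => rfl
  | tail _ h ih => exact ih.trans (hedge _ _ h)

theorem dotProduct_symLaplacian_mulVec (x : Fin N → ℝ) :
    x ⬝ᵥ (G.symLaplacian *ᵥ x) = x ⬝ᵥ (G.laplacian *ᵥ x) := by
  have h : x ⬝ᵥ (G.laplacianᵀ *ᵥ x) = x ⬝ᵥ (G.laplacian *ᵥ x) := by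
    rw [Matrix.mulVec_transpose, dotProduct_comm, ← Matrix.dotProduct_mulVec]
  rw [symLaplacian, Matrix.smul_mulVec, Matrix.add_mulVec, dotProduct_smul, dotProduct_add, h,
    smul_eq_mul]
  ring

variable (G) in
theorem eigenvalue_monotone : Monotone G.eigenvalue := by
  intro i j hij
  apply G.symLaplacian_isHermitian.eigenvalues₀_antitone
  simpa using hij

variable (G) in
theorem exists_orthonormal_eigenvectors : ∃ v : Fin N → Fin N → ℝ,
    (∀ k, G.symLaplacian *ᵥ v k = G.eigenvalue k • v k) ∧
    (∀ x y : Fin N → ℝ, x ⬝ᵥ y = ∑ k, (v k ⬝ᵥ x) * (v k ⬝ᵥ y)) ∧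
    ∀ j k, v j ⬝ᵥ v k = if j = k then 1 else 0 := by
  let hS := G.symLaplacian_isHermitian
  -- The reversal matches the decreasing order of `eigenvalues₀` with the increasing order of
  -- `eigenvalue`.
  let e : Fin N ≃ Fin N := (Fin.revPerm.trans (finCongr (Fintype.card_fin N).symm)).trans
    (Fintype.equivOfCardEq (Fintype.card_fin _))
  let b := hS.eigenvectorBasis.reindex e.symm
  have hin : ∀ x y : EuclideanSpace ℝ (Fin N), inner ℝ x y = x.ofLp ⬝ᵥ y.ofLp := by
    intro x y
    rw [EuclideanSpace.inner_eq_star_dotProduct, dotProduct_comm]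
    simp
  refine ⟨fun k => (b k).ofLp, fun k => ?_, fun x y => ?_, fun j k => ?_⟩
  · have h1 := hS.mulVec_eigenvectorBasis (e k)
    have h2 : hS.eigenvalues (e k) = G.eigenvalue k := by
      simp [Matrix.IsHermitian.eigenvalues, eigenvalue, e]
    rw [h2] at h1
    simpa [b] using h1
  · have := b.sum_inner_mul_inner (WithLp.toLp 2 x) (WithLp.toLp 2 y)
    simp only [hin] at this
    rw [← this]
    refine Finset.sum_congr rfl fun k _ => ?_
    rw [dotProduct_comm]
  · rw [← hin]
    exact orthonormal_iff_ite.1 b.orthonormal j k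

theorem dotProduct_symLaplacian_mulVec_eq_sum {v : Fin N → Fin N → ℝ}
    (hv : ∀ k, G.symLaplacian *ᵥ v k = G.eigenvalue k • v k)
    (hp : ∀ x y : Fin N → ℝ, x ⬝ᵥ y = ∑ k, (v k ⬝ᵥ x) * (v k ⬝ᵥ y)) (x : Fin N → ℝ) :
    x ⬝ᵥ (G.symLaplacian *ᵥ x) = ∑ k, G.eigenvalue k * (v k ⬝ᵥ x) ^ 2 := by
  rw [hp]
  refine Finset.sum_congr rfl fun k _ => ?_
  have hsymm : G.symLaplacianᵀ = G.symLaplacian := by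
    simpa using G.symLaplacian_isHermitian.eq
  have : v k ⬝ᵥ (G.symLaplacian *ᵥ x) = G.eigenvalue k * (v k ⬝ᵥ x) := by
    rw [Matrix.dotProduct_mulVec, ← Matrix.mulVec_transpose, hsymm, hv, smul_dotProduct,
      smul_eq_mul]
  rw [this]
  ring

theorem dotProduct_laplacian_mulVec_le (hN : 1 < N) (x : Fin N → ℝ) :
    x ⬝ᵥ (G.laplacian *ᵥ x) ≤ G.eigenvalue ⟨N - 1, Nat.sub_one_lt_of_lt hN⟩ * (x ⬝ᵥ x) := by
  obtain ⟨v, hv, hp, -⟩ := G.exists_orthonormal_eigenvectors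
  rw [← dotProduct_symLaplacian_mulVec, dotProduct_symLaplacian_mulVec_eq_sum hv hp, hp x x,
    Finset.mul_sum]
  refine Finset.sum_le_sum fun k _ => ?_
  rw [← sq]
  refine mul_le_mul_of_nonneg_right (G.eigenvalue_monotone ?_) (sq_nonneg _)
  rw [Fin.le_def]
  have := k.2
  show (k : ℕ) ≤ N - 1
  omega

/-- The quadratic form at the `i`-th basis vector is the diagonal entry of `L`, which is the
in-degree as there are no self-loops. -/
theorem inDegree_le_eigenvalue (hN : 1 < N) (i : Fin N) :
    G.inDegree i ≤ G.eigenvalue ⟨N - 1, Nat.sub_one_lt_of_lt hN⟩ := by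
  have := dotProduct_laplacian_mulVec_le (G := G) hN (Pi.single i 1)
  simpa [laplacian, G.weight_self] using this

theorem sum_sq_weighted_difference_le {b : Fin N → Fin N → ℝ} (hb : ∀ i j, 0 ≤ b i j) {r : ℝ}
    (hr : ∀ i, ∑ j, b i j ≤ r) (x : Fin N → ℝ) :
    ∑ i, (∑ j, b i j * (x i - x j)) ^ 2 ≤ r * ∑ i, ∑ j, b i j * (x i - x j) ^ 2 := by
  rw [Finset.mul_sum]
  refine Finset.sum_le_sum fun i _ => ?_
  have hnn : ∀ j, 0 ≤ b i j * (x i - x j) ^ 2 := fun j => mul_nonneg (hb i j) (sq_nonneg _)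
  refine (Finset.sum_sq_le_sum_mul_sum_of_sq_le_mul (r := fun j => b i j * (x i - x j))
    Finset.univ (fun j _ => hb i j) (fun j _ => hnn j) (fun j _ => le_of_eq (by ring))).trans ?_
  exact mul_le_mul_of_nonneg_right (hr i) (Finset.sum_nonneg fun j _ => hnn j)

/-- Weighted Cauchy–Schwarz on each row, with row weight at most `λ_N`. Bounding by the quadratic
form rather than by `x ⬝ᵥ x` lets the dissipation `z ⬝ᵥ L z` absorb such terms. -/
theorem WeightBalanced.laplacian_mulVec_sq_le (hbal : G.WeightBalanced) (hN : 1 < N)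
    (x : Fin N → ℝ) :
    (G.laplacian *ᵥ x) ⬝ᵥ (G.laplacian *ᵥ x) ≤
      2 * G.eigenvalue ⟨N - 1, Nat.sub_one_lt_of_lt hN⟩ * (x ⬝ᵥ (G.laplacian *ᵥ x)) := by
  have := sum_sq_weighted_difference_le G.weight_nonneg (inDegree_le_eigenvalue (G := G) hN) x
  rw [hbal.dotProduct_laplacian_mulVec]
  simp only [dotProduct, ← sq, laplacian_mulVec_apply]
  linarith

theorem WeightBalanced.transpose_laplacian_mulVec_sq_le (hbal : G.WeightBalanced) (hN : 1 < N)
    (x : Fin N → ℝ) :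
    (G.laplacianᵀ *ᵥ x) ⬝ᵥ (G.laplacianᵀ *ᵥ x) ≤
      2 * G.eigenvalue ⟨N - 1, Nat.sub_one_lt_of_lt hN⟩ * (x ⬝ᵥ (G.laplacian *ᵥ x)) := by
  have := sum_sq_weighted_difference_le (b := fun i j => G.weight j i)
    (fun i j => G.weight_nonneg j i)
    (fun i => (hbal i).symm.trans_le (inDegree_le_eigenvalue (G := G) hN i)) x
  have h2 : ∑ i, ∑ j, G.weight j i * (x i - x j) ^ 2 =
      ∑ i, ∑ j, G.weight i j * (x i - x j) ^ 2 := by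
    rw [Finset.sum_comm]
    refine Finset.sum_congr rfl fun i _ => Finset.sum_congr rfl fun j _ => ?_
    ring
  rw [h2] at this
  rw [hbal.dotProduct_laplacian_mulVec]
  simp only [dotProduct, ← sq, hbal.transpose_laplacian_mulVec_apply]
  linarith

/-- Otherwise the first two eigenvectors would both be constant, and two constant unit vectors are
not orthogonal. -/
theorem StronglyConnected.eigenvalue_one_pos (hconn : G.StronglyConnected)
    (hbal : G.WeightBalanced) (hN : 1 < N) : 0 < G.eigenvalue ⟨1, hN⟩ := by
  obtain ⟨v, hv, hp, ho⟩ := G.exists_orthonormal_eigenvectors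
  by_contra! hle
  have hconst : ∀ k : Fin N, k ≤ ⟨1, hN⟩ → ∀ i j, v k i = v k j := by
    intro k hk
    refine hconn.eq_of_dotProduct_laplacian_mulVec_le_zero hbal ?_
    rw [← dotProduct_symLaplacian_mulVec, hv, dotProduct_smul, ho, if_pos rfl]
    simpa using (G.eigenvalue_monotone hk).trans hle
  let z : Fin N := ⟨0, by omega⟩
  let o : Fin N := ⟨1, hN⟩
  have hz : ∀ i, v z i = v z z := fun i => hconst z (by simp [z, Fin.le_def]) i z
  have ho' : ∀ i, v o i = v o z := fun i => hconst o le_rfl i z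
  have h1 := ho z o
  have h2 := ho z z
  have h3 := ho o o
  have hne : z ≠ o := by simp [z, o]
  simp only [dotProduct, hz, ho', if_neg hne, if_true, Finset.sum_const, Finset.card_univ,
    Fintype.card_fin, nsmul_eq_mul] at h1 h2 h3
  have hN' : (N : ℝ) ≠ 0 := by positivity
  rcases mul_eq_zero.1 h1 with h | h
  · exact hN' h
  · rcases mul_eq_zero.1 h with h | h <;> simp [h] at h2 h3

/-- The constants lie in the kernel of `Sym(L)` by balance, hence are orthogonal to all eigenvectors
with positive eigenvalue. They span the line of the first eigenvector, so mean-free vectors have no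
component on it. -/
theorem StronglyConnected.le_dotProduct_laplacian_mulVec (hconn : G.StronglyConnected)
    (hbal : G.WeightBalanced) (hN : 1 < N) {x : Fin N → ℝ} (hx : ∑ i, x i = 0) :
    G.eigenvalue ⟨1, hN⟩ * (x ⬝ᵥ x) ≤ x ⬝ᵥ (G.laplacian *ᵥ x) := by
  obtain ⟨v, hv, hp, ho⟩ := G.exists_orthonormal_eigenvectors
  have hpos := hconn.eigenvalue_one_pos hbal hN
  let z : Fin N := ⟨0, by omega⟩
  have hge : ∀ k : Fin N, k ≠ z → G.eigenvalue ⟨1, hN⟩ ≤ G.eigenvalue k := by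
    intro k hk
    apply G.eigenvalue_monotone
    rw [Fin.le_def]
    have : (k : ℕ) ≠ 0 := fun h => hk (Fin.ext h)
    show 1 ≤ (k : ℕ)
    omega
  let u : Fin N → ℝ := fun _ => 1
  have hu : ∑ k, G.eigenvalue k * (v k ⬝ᵥ u) ^ 2 = 0 := by
    rw [← dotProduct_symLaplacian_mulVec_eq_sum hv hp, dotProduct_symLaplacian_mulVec,
      laplacian_mulVec_const, dotProduct_zero]
  have hsymm : G.symLaplacianᵀ = G.symLaplacian := by
    simpa using G.symLaplacian_isHermitian.eq
  have hSu : G.symLaplacian *ᵥ u = 0 := by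
    have h2 : (G.laplacianᵀ *ᵥ u) = 0 := by
      ext i
      simp [u, hbal.transpose_laplacian_mulVec_apply]
    rw [symLaplacian, Matrix.smul_mulVec, Matrix.add_mulVec, h2, laplacian_mulVec_const]
    simp
  have hu0 : ∀ k, k ≠ z → v k ⬝ᵥ u = 0 := by
    intro k hk
    have h1 : G.eigenvalue k * (v k ⬝ᵥ u) = v k ⬝ᵥ (G.symLaplacian *ᵥ u) := by
      rw [Matrix.dotProduct_mulVec, ← Matrix.mulVec_transpose, hsymm, hv, smul_dotProduct,
        smul_eq_mul]
    rw [hSu, dotProduct_zero] at h1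
    exact (mul_eq_zero.1 h1).resolve_left (hpos.trans_le (hge k hk)).ne'
  have hux : u ⬝ᵥ x = 0 := by simpa [u, dotProduct] using hx
  have huu : u ⬝ᵥ u ≠ 0 := by
    have : (N : ℝ) ≠ 0 := by positivity
    simpa [u, dotProduct] using this
  have hzx : v z ⬝ᵥ x = 0 := by
    rw [hp, Finset.sum_eq_single z (fun k _ hk => by simp [hu0 k hk]) (by simp)] at hux huu
    exact (mul_eq_zero.1 hux).resolve_left fun h => huu (by simp [h])
  rw [← dotProduct_symLaplacian_mulVec, dotProduct_symLaplacian_mulVec_eq_sum hv hp, hp x x,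
    Finset.mul_sum]
  refine Finset.sum_le_sum fun k _ => ?_
  rcases eq_or_ne k z with rfl | hk
  · simp [hzx]
  · rw [← sq]
    exact mul_le_mul_of_nonneg_right (hge k hk) (sq_nonneg _)

/-- Adding the all-ones matrix `J` makes `L` invertible. Summing the coordinates of `(L + J) x = y`
forces the sum of `x` to vanish, so the solution already satisfies `L x = y`. -/
theorem StronglyConnected.exists_laplacian_mulVec_eq (hconn : G.StronglyConnected)
    (hbal : G.WeightBalanced) (hN : 1 < N) {y : Fin N → ℝ} (hy : ∑ i, y i = 0) :
    ∃ x, G.laplacian *ᵥ x = y := by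
  let J : Matrix (Fin N) (Fin N) ℝ := Matrix.of fun _ _ => 1
  have hJ : ∀ x : Fin N → ℝ, J *ᵥ x = fun _ => ∑ i, x i := by
    intro x
    ext i
    simp [J, Matrix.mulVec, dotProduct]
  have hN' : (0 : ℝ) < N := by positivity
  have hinj : Function.Injective (G.laplacian + J).mulVecLin := by
    rw [injective_iff_map_eq_zero]
    intro x hx
    rw [Matrix.mulVecLin_apply, Matrix.add_mulVec, hJ] at hx
    have hs : ∑ i, x i = 0 := by
      have h1 := congrArg (fun y : Fin N → ℝ => ∑ i, y i) hx
      simp only [Pi.add_apply, Finset.sum_add_distrib, hbal.sum_laplacian_mulVec] at h1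
      simpa [hN'.ne', Nat.cast_eq_zero] using h1
    have hL : G.laplacian *ᵥ x = 0 := by
      rw [hs] at hx
      exact (add_zero _).symm.trans hx
    have h1 := hconn.le_dotProduct_laplacian_mulVec hbal hN hs
    rw [hL, dotProduct_zero] at h1
    have h2 : x ⬝ᵥ x ≤ 0 := nonpos_of_mul_nonpos_right h1 (hconn.eigenvalue_one_pos hbal hN)
    exact dotProduct_self_eq_zero.1 (le_antisymm h2
      (Finset.sum_nonneg fun i _ => mul_self_nonneg (x i)))
  obtain ⟨x, hx⟩ := LinearMap.surjective_of_injective hinj y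
  refine ⟨x, ?_⟩
  rw [Matrix.mulVecLin_apply, Matrix.add_mulVec, hJ] at hx
  have hs : ∑ i, x i = 0 := by
    have h1 := congrArg (fun y : Fin N → ℝ => ∑ i, y i) hx
    simp only [Pi.add_apply, Finset.sum_add_distrib, hbal.sum_laplacian_mulVec, hy] at h1
    simpa [hN'.ne', Nat.cast_eq_zero] using h1
  rw [hs] at hx
  exact (add_zero _).symm.trans hx

end WeightedDigraph

/-! ### Convergence of the primal-dual optimal signal generator -/

section Euclidean

variable {ι : Type*} [Fintype ι]

theorem dotProduct_self_nonneg (u : ι → ℝ) : 0 ≤ u ⬝ᵥ u :=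
  Finset.sum_nonneg fun i _ => mul_self_nonneg (u i)

theorem dotProduct_self_add_smul (u v : ι → ℝ) (r : ℝ) :
    (u + r • v) ⬝ᵥ (u + r • v) = u ⬝ᵥ u + 2 * r * (u ⬝ᵥ v) + r ^ 2 * (v ⬝ᵥ v) := by
  simp only [add_dotProduct, dotProduct_add, smul_dotProduct, dotProduct_smul, smul_eq_mul,
    dotProduct_comm v u]
  ring

theorem dotProduct_self_add_le (u v : ι → ℝ) :
    (u + v) ⬝ᵥ (u + v) ≤ 2 * (u ⬝ᵥ u + v ⬝ᵥ v) := by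
  have h1 := dotProduct_self_nonneg (u - v)
  simp only [add_dotProduct, dotProduct_add, sub_dotProduct, dotProduct_sub,
    dotProduct_comm v u] at h1 ⊢
  linarith

theorem dotProduct_self_add_add_le (u v w : ι → ℝ) :
    (u + v + w) ⬝ᵥ (u + v + w) ≤ 3 * (u ⬝ᵥ u + v ⬝ᵥ v + w ⬝ᵥ w) := by
  have h1 := dotProduct_self_nonneg (u - v)
  have h2 := dotProduct_self_nonneg (u - w)
  have h3 := dotProduct_self_nonneg (v - w)
  simp only [add_dotProduct, dotProduct_add, sub_dotProduct, dotProduct_sub,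
    dotProduct_comm v u, dotProduct_comm w u, dotProduct_comm w v] at h1 h2 h3 ⊢
  linarith

end Euclidean

variable {N : ℕ}

/-- Subtraction of the average. -/
def deviation (x : Fin N → ℝ) : Fin N → ℝ := fun i => x i - (∑ j, x j) / N

theorem sum_deviation (hN : 0 < N) (x : Fin N → ℝ) : ∑ i, deviation x i = 0 := by
  have : (N : ℝ) ≠ 0 := by positivity
  simp only [deviation, Finset.sum_sub_distrib, Finset.sum_const, Finset.card_univ,
    Fintype.card_fin, nsmul_eq_mul]
  field_simp
  ring

theorem deviation_eq_sub (x : Fin N → ℝ) :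
    deviation x = x - ((∑ j, x j) / N) • fun _ => (1 : ℝ) := by
  ext i
  simp [deviation]

theorem dotProduct_deviation {y : Fin N → ℝ} (hy : ∑ i, y i = 0) (x : Fin N → ℝ) :
    y ⬝ᵥ deviation x = y ⬝ᵥ x := by
  rw [deviation_eq_sub, dotProduct_sub, dotProduct_smul]
  have : (y ⬝ᵥ fun _ => (1 : ℝ)) = 0 := by simpa [dotProduct] using hy
  rw [this, smul_zero, sub_zero]

theorem deviation_dotProduct_self_le (hN : 0 < N) (x : Fin N → ℝ) :
    deviation x ⬝ᵥ deviation x ≤ x ⬝ᵥ x := by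
  have h1 := dotProduct_deviation (sum_deviation hN x) x
  have h2 := dotProduct_self_nonneg (x - deviation x)
  simp only [sub_dotProduct, dotProduct_sub, dotProduct_comm x (deviation x)] at h2
  linarith

theorem WeightedDigraph.laplacian_mulVec_deviation (G : WeightedDigraph N) (x : Fin N → ℝ) :
    G.laplacian *ᵥ deviation x = G.laplacian *ᵥ x := by
  rw [deviation_eq_sub, Matrix.mulVec_sub, Matrix.mulVec_smul, G.laplacian_mulVec_const,
    smul_zero, sub_zero]

/-- The arithmetic of `lyapunov_decrease`, with `a = |Y|²`, `b = |z|²`, `p = Y·LY`, `q = z·Lz`, `s =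
Y·h`, `m = z·LY`, `g = z·h`, `H = |h|²`, `D = |deviation h|²`, `Q = |LY|²`, `R = |Lz|²`, `T =
|Lᵀz|²`; `W` and `W'` are the squared norms of the two increments divided by `-γ`. -/
theorem lyapunov_scalar_decrease {l lbar α β γ c κ lam2 lamN a b p q s m g H D Q R T W W' : ℝ}
    (hα : 0 < α) (hγ : 0 < γ) (hc : 0 < c) (hκ : 0 < κ) (hcβ : 0 < β - c)
    (hpos : 0 < lam2) (hlam : lam2 ≤ lamN)
    (hκl : κ * c * α * lbar ^ 2 ≤ lam2 * l)
    (hY : γ * (4 * κ * c ^ 2 * lamN ^ 2 + 6 * lamN ^ 2) ≤ 1 / 4 * (κ * c * lam2))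
    (hq : 6 * γ * (β - c) * lamN ≤ 1)
    (hz : γ * (2 * κ * c ^ 2 + 3) * α * lbar ^ 2 ≤ 1 / 2 * l)
    (hm : 4 * lamN ≤ κ * c * lam2 * (β - c))
    (ha : 0 ≤ a) (hb : 0 ≤ b) (hp : lam2 * a ≤ p) (hp' : p ≤ lamN * a)
    (hQ : Q ≤ 2 * lamN * p) (hR : R ≤ 2 * lamN * q) (hT : T ≤ 2 * lamN * q) (hq0 : 0 ≤ q)
    (hg : l * b ≤ g) (hH : H ≤ lbar ^ 2 * b) (hD : D ≤ H)
    (hW : W ≤ 2 * (c ^ 2 * Q + (c * α) ^ 2 * D))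
    (hW' : W' ≤ 3 * ((β - c) ^ 2 * R + Q + α ^ 2 * H))
    (hs : 0 ≤ lam2 ^ 2 * a + 2 * α * lam2 * s + α ^ 2 * H)
    (hmm : 0 ≤ (κ * c * lam2 / 2) ^ 2 * a + κ * c * lam2 * m + T) :
    κ * (a + 2 * (-γ) * (c * p + c * α * s) + (-γ) ^ 2 * W) +
      (b + 2 * (-γ) * ((β - c) * q + m + α * g) + (-γ) ^ 2 * W') ≤
    κ * a + b - γ * (1 / 4 * (κ * c * lam2) * a + 1 / 2 * (α * l) * b) := by
  have hΛ : 0 < lamN := hpos.trans_le hlam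
  set k := κ * c * lam2 with hk
  have hkpos : 0 < k := by positivity
  have hQ' : Q ≤ 2 * lamN ^ 2 * a := by
    have := mul_le_mul_of_nonneg_left hp' (by positivity : 0 ≤ 2 * lamN)
    linarith
  have hcross : -(2 * (κ * c * α) * s) ≤ k * a + α * l * b := by
    have h1 : α ^ 2 * H ≤ α ^ 2 * (lbar ^ 2 * b) := by gcongr
    have h2 : 0 ≤ κ * c * (lam2 ^ 2 * a + 2 * α * lam2 * s + α ^ 2 * (lbar ^ 2 * b)) :=
      mul_nonneg (by positivity) (by linarith)
    have h3 := mul_le_mul_of_nonneg_right hκl (by positivity : 0 ≤ α * b)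
    refine le_of_mul_le_mul_left ?_ hpos
    rw [hk]
    linarith
  have hcross' : -(2 * m) ≤ k / 2 * a + (β - c) * q := by
    have h1 := mul_le_mul_of_nonneg_right hm hq0
    refine le_of_mul_le_mul_left ?_ hkpos
    linarith
  have hW1 : κ * W ≤ 4 * κ * c ^ 2 * lamN ^ 2 * a + 2 * κ * c ^ 2 * α ^ 2 * lbar ^ 2 * b := by
    have h1 := mul_le_mul_of_nonneg_left hQ' (by positivity : 0 ≤ c ^ 2)
    have h2 := mul_le_mul_of_nonneg_left (hD.trans hH) (by positivity : 0 ≤ (c * α) ^ 2)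
    have h3 := mul_le_mul_of_nonneg_left
      (hW.trans (by linarith : _ ≤ 2 * (c ^ 2 * (2 * lamN ^ 2 * a) + (c * α) ^ 2 * (lbar ^ 2 * b))))
      hκ.le
    linarith
  have hW1' : W' ≤ 6 * (β - c) ^ 2 * lamN * q + 6 * lamN ^ 2 * a + 3 * α ^ 2 * lbar ^ 2 * b := by
    have h1 := mul_le_mul_of_nonneg_left hR (by positivity : 0 ≤ (β - c) ^ 2)
    have h2 := mul_le_mul_of_nonneg_left hH (by positivity : 0 ≤ α ^ 2)
    linarith
  have e1 := mul_le_mul_of_nonneg_right hY ha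
  have e2 := mul_le_mul_of_nonneg_right hq (by positivity : 0 ≤ (β - c) * q)
  have e3 := mul_le_mul_of_nonneg_right hz (by positivity : 0 ≤ α * b)
  have e4 := mul_le_mul_of_nonneg_left hp (by positivity : 0 ≤ κ * c)
  have e5 := mul_le_mul_of_nonneg_left hg hα.le
  have e6 := mul_le_mul_of_nonneg_left (add_le_add hW1 hW1') hγ.le
  -- The budget: of the dissipation `2 k a`, the cross terms take `k a` and `k a / 2` and the
  -- second-order terms `k a / 4`. Of `2 α l b` they take `α l b` and `α l b / 2`. The dissipation
  -- `2 (β - c) q` is used up, half by `m` and half by `W'`.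
  have key : -(2 * κ * c * p) - 2 * (κ * c * α) * s - 2 * (β - c) * q - 2 * m - 2 * (α * g) +
      γ * (κ * W + W') ≤ -(1 / 4 * k * a + 1 / 2 * (α * l) * b) := by
    have e4' : k * a ≤ κ * c * p := by rw [hk]; linarith
    linarith
  have := mul_le_mul_of_nonneg_left key hγ.le
  linarith

/-- Decrease of the weighted Lyapunov function along one step of the optimal signal generator,
in coordinates in which its linear part is block triangular. -/
theorem lyapunov_decrease {G : WeightedDigraph N} (hN : 1 < N) (hconn : G.StronglyConnected)
    (hbal : G.WeightBalanced) {l lbar α β γ c κ lam2 lamN : ℝ}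
    (hlam2 : lam2 = G.eigenvalue ⟨1, hN⟩)
    (hlamN : lamN = G.eigenvalue ⟨N - 1, Nat.sub_one_lt_of_lt hN⟩)
    (hα : 0 < α) (hγ : 0 < γ) (hc : 0 < c) (hκ : 0 < κ) (hcβ : 0 < β - c)
    (hκl : κ * c * α * lbar ^ 2 ≤ lam2 * l)
    (hY : γ * (4 * κ * c ^ 2 * lamN ^ 2 + 6 * lamN ^ 2) ≤ 1 / 4 * (κ * c * lam2))
    (hq : 6 * γ * (β - c) * lamN ≤ 1)
    (hz : γ * (2 * κ * c ^ 2 + 3) * α * lbar ^ 2 ≤ 1 / 2 * l)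
    (hm : 4 * lamN ≤ κ * c * lam2 * (β - c))
    {z Y h : Fin N → ℝ} (hYsum : ∑ i, Y i = 0)
    (hzh : l * (z ⬝ᵥ z) ≤ z ⬝ᵥ h) (hh : h ⬝ᵥ h ≤ lbar ^ 2 * (z ⬝ᵥ z)) :
    κ * ((Y + (-γ) • (c • (G.laplacian *ᵥ Y) + (c * α) • deviation h)) ⬝ᵥ
        (Y + (-γ) • (c • (G.laplacian *ᵥ Y) + (c * α) • deviation h))) +
      (z + (-γ) • ((β - c) • (G.laplacian *ᵥ z) + G.laplacian *ᵥ Y + α • h)) ⬝ᵥ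
        (z + (-γ) • ((β - c) • (G.laplacian *ᵥ z) + G.laplacian *ᵥ Y + α • h)) ≤
    κ * (Y ⬝ᵥ Y) + z ⬝ᵥ z -
      γ * (1 / 4 * (κ * c * lam2) * (Y ⬝ᵥ Y) + 1 / 2 * (α * l) * (z ⬝ᵥ z)) := by
  have hpos : 0 < lam2 := hlam2 ▸ hconn.eigenvalue_one_pos hbal hN
  have hlam : lam2 ≤ lamN := by
    rw [hlam2, hlamN]
    exact G.eigenvalue_monotone (by rw [Fin.le_def]; show 1 ≤ N - 1; omega)
  have hp := hconn.le_dotProduct_laplacian_mulVec hbal hN hYsum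
  have hp' := WeightedDigraph.dotProduct_laplacian_mulVec_le (G := G) hN Y
  have hLY := hbal.laplacian_mulVec_sq_le hN Y
  have hLz := hbal.laplacian_mulVec_sq_le hN z
  have hLTz := hbal.transpose_laplacian_mulVec_sq_le hN z
  have hq0 := hbal.dotProduct_laplacian_mulVec_nonneg z
  rw [← hlam2] at hp
  rw [← hlamN] at hp' hLY hLz hLTz
  -- Moving `L` onto `z` lets the cross term be paid partly by `z·Lz`, which bounds `|Lᵀz|²`.
  have hm' : z ⬝ᵥ (G.laplacian *ᵥ Y) = Y ⬝ᵥ (G.laplacianᵀ *ᵥ z) := by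
    rw [Matrix.mulVec_transpose, Matrix.dotProduct_mulVec, dotProduct_comm]
  have hdev := deviation_dotProduct_self_le (by omega : 0 < N) h
  have hdev' := dotProduct_deviation hYsum h
  have hW := dotProduct_self_add_le (c • (G.laplacian *ᵥ Y)) ((c * α) • deviation h)
  have hW' := dotProduct_self_add_add_le ((β - c) • (G.laplacian *ᵥ z)) (G.laplacian *ᵥ Y) (α • h)
  have hs := dotProduct_self_nonneg (lam2 • Y + α • h)
  have hmm := dotProduct_self_nonneg
    ((κ * c * lam2 / 2) • Y + (1 : ℝ) • (G.laplacianᵀ *ᵥ z))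
  have ha := dotProduct_self_nonneg Y
  have hb := dotProduct_self_nonneg z
  rw [dotProduct_self_add_smul Y, dotProduct_self_add_smul z]
  rw [dotProduct_self_add_smul] at hs hmm
  simp only [dotProduct_smul, smul_dotProduct, smul_eq_mul] at hW hW' hs hmm
  generalize (c • (G.laplacian *ᵥ Y) + (c * α) • deviation h) ⬝ᵥ
    (c • (G.laplacian *ᵥ Y) + (c * α) • deviation h) = W at *
  generalize ((β - c) • (G.laplacian *ᵥ z) + G.laplacian *ᵥ Y + α • h) ⬝ᵥ
    ((β - c) • (G.laplacian *ᵥ z) + G.laplacian *ᵥ Y + α • h) = W' at *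
  simp only [dotProduct_add, dotProduct_smul, smul_eq_mul, hdev']
  rw [← hm'] at hmm
  refine lyapunov_scalar_decrease hα hγ hc hκ hcβ hpos hlam hκl hY hq hz hm ha hb hp hp' hLY hLz
    hLTz hq0 hzh hh hdev ?_ ?_ ?_ ?_ <;> linarith

/-- The smaller root is taken: it stays below `2 α` and leaves `β - c ≥ β / 2` as damping for `z`.
The root is real since `β ≥ 4 α`. -/
theorem exists_decoupling_root {α β : ℝ} (hα : 1 ≤ α) (hβ : 4 * α ^ 2 ≤ β) :
    ∃ c, 0 < c ∧ c ≤ 2 * α ∧ c ≤ β / 2 ∧ c ^ 2 - β * c + α * β = 0 := by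
  have h1 : 4 * α ≤ β := by nlinarith
  have hβ0 : 0 < β := by linarith
  have hd : 0 ≤ β ^ 2 - 4 * α * β := by nlinarith
  have hsq := Real.sq_sqrt hd
  have h0 := Real.sqrt_nonneg (β ^ 2 - 4 * α * β)
  have hlt : √(β ^ 2 - 4 * α * β) < β := by
    rw [Real.sqrt_lt' hβ0]
    nlinarith
  have hge : β - 4 * α ≤ √(β ^ 2 - 4 * α * β) := by
    apply Real.le_sqrt_of_sq_le
    nlinarith
  refine ⟨(β - √(β ^ 2 - 4 * α * β)) / 2, by linarith, by linarith, by linarith, ?_⟩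
  nlinarith

/-- The scalar inequalities behind the decrease of the Lyapunov function, with
`k = κ c` for the weight `κ`. -/
theorem step_size_bounds {l lbar α β γ c lam2 lamN : ℝ} (hl : 0 < l) (hlbar : l ≤ lbar)
    (hlam2 : 0 < lam2) (hlam : lam2 ≤ lamN) (hα : 1 ≤ α) (hαl : 1 ≤ α * l)
    (hαlam : 2 * lbar ^ 2 ≤ α * l * lam2) (hβ : 4 * α ^ 2 * lamN ^ 2 ≤ β * lam2 ^ 2)
    (hγ : 0 < γ) (hγ' : γ * (β ^ 4 * (lamN ^ 2 + lbar ^ 2)) ≤ 1)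
    (hc : 0 < c) (hcα : c ≤ 2 * α) (hcβ : c ≤ β / 2) :
    ∃ k, 0 < k ∧ k * α * lbar ^ 2 ≤ lam2 * l ∧
      γ * (4 * k * c * lamN ^ 2 + 6 * lamN ^ 2) ≤ 1 / 4 * (k * lam2) ∧
      6 * γ * (β - c) * lamN ≤ 1 ∧
      γ * (2 * k * c + 3) * α * lbar ^ 2 ≤ 1 / 2 * l ∧
      4 * lamN ≤ k * lam2 * (β - c) := by
  have hlbar0 : 0 < lbar := hl.trans_le hlbar
  have hΛ : 0 < lamN := hlam2.trans_le hlam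
  have hα0 : 0 < α := by linarith
  have hββ : 4 * α ^ 2 ≤ β := by
    have h1 : 4 * α ^ 2 * lam2 ^ 2 ≤ β * lam2 ^ 2 := by
      refine le_trans ?_ hβ
      gcongr
    exact le_of_mul_le_mul_right h1 (by positivity)
  have hβ4 : 4 ≤ β := by nlinarith
  have hβ4' : 256 * α ^ 8 ≤ β ^ 4 := by
    calc 256 * α ^ 8 = (4 * α ^ 2) ^ 4 := by ring
      _ ≤ β ^ 4 := by gcongr
  have hαlbar : 1 ≤ α * lbar := hαl.trans (by gcongr)
  have hlam2' : 2 ≤ α ^ 2 * lam2 := by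
    have h1 : 2 * (lbar * 1) ≤ 2 * (lbar * (α * lbar)) := by gcongr
    have h2 : α * (2 * lbar ^ 2) ≤ α * (α * l * lam2) := by gcongr
    have h3 : 2 * l ≤ α ^ 2 * lam2 * l := by linarith
    exact le_of_mul_le_mul_right h3 hl
  have hΓ1 : γ * β ^ 4 * lamN ^ 2 ≤ 1 := by
    have : 0 ≤ γ * β ^ 4 * lbar ^ 2 := by positivity
    linarith
  have hΓ2 : γ * β ^ 4 * lbar ^ 2 ≤ 1 := by
    have : 0 ≤ γ * β ^ 4 * lamN ^ 2 := by positivity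
    linarith
  -- A bound linear in `lamN`: `2 * lamN * lbar ≤ lamN ^ 2 + lbar ^ 2`, and `1 ≤ α * lbar` removes
  -- the factor `lbar`.
  have hΓ3 : 2 * (γ * β ^ 4 * lamN) ≤ α := by
    have h0 : 0 ≤ γ * β ^ 4 * (lamN - lbar) ^ 2 := by positivity
    have h1 : 2 * (γ * β ^ 4 * lamN) * 1 ≤ 2 * (γ * β ^ 4 * lamN) * (α * lbar) := by gcongr
    have h2 : α * (2 * (γ * β ^ 4 * lamN) * lbar) ≤ α * 1 := by
      gcongr
      linarith
    linarith
  -- The largest `k` compatible with the first bound. The bound on `m` needs `k` large, and `hαlam`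
  -- guarantees `k * α ^ 2 ≥ 2`.
  refine ⟨lam2 * l / (α * lbar ^ 2), by positivity, le_of_eq (by field_simp), ?_⟩
  set k := lam2 * l / (α * lbar ^ 2) with hk
  have hk0 : 0 < k := by positivity
  have hk1 : k * (α * lbar ^ 2) = lam2 * l := by rw [hk]; field_simp
  have hk2 : 2 ≤ k * α ^ 2 := by
    refine le_of_mul_le_mul_right ?_ (by positivity : 0 < lbar ^ 2)
    have : k * α ^ 2 * lbar ^ 2 = α * l * lam2 := by linear_combination α * hk1
    linarith
  have hα8 : ∀ {n : ℕ}, n ≤ 8 → α ^ n ≤ α ^ 8 := fun h => pow_le_pow_right₀ hα h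
  refine ⟨?_, ?_, ?_, ?_⟩
  · have h1 : 4 * γ * c * lamN ^ 2 ≤ lam2 / 8 := by
      refine le_of_mul_le_mul_right ?_ (by positivity : 0 < β ^ 4)
      have e1 : 4 * γ * c * lamN ^ 2 * β ^ 4 ≤ 4 * c := by
        have := mul_le_mul_of_nonneg_left hΓ1 (by positivity : 0 ≤ 4 * c)
        linarith
      have e2 : lam2 / 8 * (256 * α ^ 8) ≤ lam2 / 8 * β ^ 4 := by gcongr
      have e3 : 2 * α ^ 6 ≤ α ^ 2 * lam2 * α ^ 6 := by gcongr
      have e4 : α ^ 1 ≤ α ^ 6 := pow_le_pow_right₀ hα (by norm_num)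
      have e5 : 0 ≤ α ^ 6 := by positivity
      linarith
    have h2 : 6 * γ * lamN ^ 2 ≤ k * lam2 / 8 := by
      refine le_of_mul_le_mul_right ?_ (by positivity : 0 < β ^ 4)
      have e1 : 6 * γ * lamN ^ 2 * β ^ 4 ≤ 6 := by linarith
      have e2 : k * lam2 / 8 * (256 * α ^ 8) ≤ k * lam2 / 8 * β ^ 4 := by gcongr
      have e3 : 2 * 2 ≤ k * α ^ 2 * (α ^ 2 * lam2) := by gcongr
      have e4 : 2 * 2 * α ^ 4 ≤ k * α ^ 2 * (α ^ 2 * lam2) * α ^ 4 := by gcongr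
      have e5 : 1 ≤ α ^ 4 := one_le_pow₀ hα
      linarith
    have h3 := mul_le_mul_of_nonneg_left h1 hk0.le
    linarith
  · have h1 : 6 * γ * (β - c) * lamN ≤ 6 * γ * β * lamN := by
      gcongr
      linarith
    refine h1.trans ?_
    refine le_of_mul_le_mul_right ?_ (by positivity : 0 < β ^ 3)
    have e1 : 64 * α ^ 6 ≤ β ^ 3 := by
      calc 64 * α ^ 6 = (4 * α ^ 2) ^ 3 := by ring
        _ ≤ β ^ 3 := by gcongr
    have e2 : α ^ 1 ≤ α ^ 6 := pow_le_pow_right₀ hα (by norm_num)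
    linarith
  · have h1 : 8 * (γ * c * lam2) ≤ 1 := by
      have e0 : 8 * (γ * c * lam2) ≤ 8 * (γ * (2 * α) * lamN) := by gcongr
      refine e0.trans ?_
      refine le_of_mul_le_mul_right ?_ (by positivity : 0 < β ^ 4)
      have e1 := mul_le_mul_of_nonneg_left hΓ3 (by positivity : 0 ≤ 8 * α)
      have e2 : α ^ 2 ≤ α ^ 8 := hα8 (by norm_num)
      have e3 : 0 ≤ α ^ 8 := by positivity
      linarith
    have h2 : 12 * (γ * α * lbar ^ 2) ≤ l := by
      refine le_of_mul_le_mul_right ?_ (by positivity : 0 < β ^ 4)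
      have e1 := mul_le_mul_of_nonneg_left hΓ2 (by positivity : 0 ≤ 12 * α)
      have e2 : l * (256 * α ^ 8) ≤ l * β ^ 4 := by gcongr
      have e3 : 1 * α ^ 7 ≤ α * l * α ^ 7 := by gcongr
      have e4 : α ^ 1 ≤ α ^ 7 := pow_le_pow_right₀ hα (by norm_num)
      have e5 : 0 ≤ α ^ 7 := by positivity
      linarith
    have h3 := mul_le_mul_of_nonneg_left h1 hl.le
    have h4 : γ * (2 * k * c + 3) * α * lbar ^ 2 =
        2 * γ * c * (k * (α * lbar ^ 2)) + 3 * (γ * α * lbar ^ 2) := by ring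
    rw [h4, hk1]
    linarith
  · have h1 : 4 * lamN ≤ k * lam2 * (β / 2) := by
      refine le_of_mul_le_mul_right ?_ (by positivity : 0 < lam2)
      have e1 : k / 2 * (4 * α ^ 2 * lamN ^ 2) ≤ k / 2 * (β * lam2 ^ 2) := by gcongr
      have e2 : 2 * lamN ^ 2 ≤ k * α ^ 2 * lamN ^ 2 := by gcongr
      have e3 : lamN * lam2 ≤ lamN * lamN := by gcongr
      linarith
    refine h1.trans ?_
    gcongr
    linarith

theorem tendsto_zero_of_le_mul {V : ℕ → ℝ} {ρ : ℝ} (hV : ∀ t, 0 ≤ V t) (hρ0 : 0 ≤ ρ)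
    (hρ : ρ < 1) (h : ∀ t, V (t + 1) ≤ ρ * V t) : Tendsto V atTop (𝓝 0) := by
  have hgeo : ∀ t, V t ≤ ρ ^ t * V 0 := by
    intro t
    induction t with
    | zero => simp
    | succ t ih =>
      refine (h t).trans ?_
      rw [pow_succ', mul_assoc]
      gcongr
  refine squeeze_zero hV hgeo ?_
  simpa using (tendsto_pow_atTop_nhds_zero_of_lt_one hρ0 hρ).mul_const (V 0)

theorem tendsto_zero_of_dotProduct_self {ι : Type*} [Fintype ι] {x : ℕ → ι → ℝ}
    (h : Tendsto (fun t => x t ⬝ᵥ x t) atTop (𝓝 0)) : Tendsto x atTop (𝓝 0) := by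
  rw [tendsto_pi_nhds]
  intro i
  have h1 : Tendsto (fun t => x t i ^ 2) atTop (𝓝 0) := by
    refine squeeze_zero (fun t => sq_nonneg _) (fun t => ?_) h
    rw [sq]
    exact Finset.single_le_sum (f := fun i => x t i * x t i)
      (fun j _ => mul_self_nonneg (x t j)) (Finset.mem_univ i)
  have h2 := h1.sqrt
  simp only [Real.sqrt_sq_eq_abs, Real.sqrt_zero] at h2
  exact (tendsto_zero_iff_abs_tendsto_zero _).2 h2

/-- The optimal signal generator converges from every initial state. -/
theorem optimalSignalGenerator_tendsto {G : WeightedDigraph N} (hN : 1 < N)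
    (hconn : G.StronglyConnected) (hbal : G.WeightBalanced) {l lbar α β γ lam2 lamN : ℝ}
    (hlam2 : lam2 = G.eigenvalue ⟨1, hN⟩)
    (hlamN : lamN = G.eigenvalue ⟨N - 1, Nat.sub_one_lt_of_lt hN⟩)
    (hl : 0 < l) (hlbar : l ≤ lbar) (hα : 1 ≤ α) (hαl : 1 ≤ α * l)
    (hαlam : 2 * lbar ^ 2 ≤ α * l * lam2) (hβ : 4 * α ^ 2 * lamN ^ 2 ≤ β * lam2 ^ 2)
    (hγ : 0 < γ) (hγ' : γ * (β ^ 4 * (lamN ^ 2 + lbar ^ 2)) ≤ 1)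
    {φ : Fin N → ℝ → ℝ} (hmono : ∀ i a b, l * |a - b| ^ 2 ≤ (φ i a - φ i b) * (a - b))
    (hlip : ∀ i a b, |φ i a - φ i b| ≤ lbar * |a - b|) {ystar : ℝ}
    (hstar : ∑ i, φ i ystar = 0) {z ζ : ℕ → Fin N → ℝ}
    (hz : ∀ t i, z (t + 1) i = z t i - γ * (α * φ i (z t i) + β * (G.laplacian *ᵥ z t) i
      + (G.laplacian *ᵥ ζ t) i))
    (hζ : ∀ t i, ζ (t + 1) i = ζ t i + γ * α * β * (G.laplacian *ᵥ z t) i) :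
    Tendsto z atTop (𝓝 fun _ => ystar) ∧ ∃ ζlim, Tendsto ζ atTop (𝓝 ζlim) := by
  have hpos : 0 < lam2 := hlam2 ▸ hconn.eigenvalue_one_pos hbal hN
  have hlam : lam2 ≤ lamN := by
    rw [hlam2, hlamN]
    exact G.eigenvalue_monotone (by rw [Fin.le_def]; show 1 ≤ N - 1; omega)
  have hα0 : 0 < α := by linarith
  have hββ : 4 * α ^ 2 ≤ β := by
    have h1 : 4 * α ^ 2 * lam2 ^ 2 ≤ β * lam2 ^ 2 := by
      refine le_trans ?_ hβ
      gcongr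
    exact le_of_mul_le_mul_right h1 (by positivity)
  have hβ0 : 0 < β := lt_of_lt_of_le (by positivity) hββ
  obtain ⟨c, hc, hcα, hcβ, hroot⟩ := exists_decoupling_root hα hββ
  obtain ⟨k, hk, hk1, hk2, hk3, hk4, hk5⟩ :=
    step_size_bounds hl hlbar hpos hlam hα hαl hαlam hβ hγ hγ' hc hcα hcβ
  obtain ⟨ζs, hζs⟩ := hconn.exists_laplacian_mulVec_eq hbal hN
    (y := fun i => -(α * φ i ystar)) (by
      rw [Finset.sum_neg_distrib, ← Finset.mul_sum, hstar, mul_zero, neg_zero])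
  have hN0 : (N : ℝ) ≠ 0 := by positivity
  set dz : ℕ → Fin N → ℝ := fun t i => z t i - ystar with hdz
  -- Only `deviation (y t)` enters the dynamics below, since `L` kills constants; this restriction
  -- makes the `λ₂` bound available.
  set y : ℕ → Fin N → ℝ := fun t => (ζ t - ζs) + c • dz t with hy
  set h : ℕ → Fin N → ℝ := fun t i => φ i (z t i) - φ i ystar with hh
  have hLdz : ∀ t, G.laplacian *ᵥ z t = G.laplacian *ᵥ dz t := by
    intro t
    have : dz t = z t - fun _ => ystar := rfl
    rw [this, Matrix.mulVec_sub, G.laplacian_mulVec_const, sub_zero]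
  have hLζ : ∀ t i, (G.laplacian *ᵥ ζ t) i =
      (G.laplacian *ᵥ deviation (y t)) i - c * (G.laplacian *ᵥ dz t) i - α * φ i ystar := by
    intro t i
    have h1 := congrFun hζs i
    rw [G.laplacian_mulVec_deviation, hy]
    simp only [Matrix.mulVec_add, Matrix.mulVec_sub, Matrix.mulVec_smul, Pi.add_apply,
      Pi.sub_apply, Pi.smul_apply, smul_eq_mul, h1]
    ring
  have hdz_step : ∀ t, dz (t + 1) = dz t + (-γ) • ((β - c) • (G.laplacian *ᵥ dz t) +
      G.laplacian *ᵥ deviation (y t) + α • h t) := by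
    intro t
    ext i
    simp only [hdz, hh, Pi.add_apply, Pi.smul_apply, smul_eq_mul, hz]
    rw [hLdz, hLζ]
    ring
  have hy_step : ∀ t, y (t + 1) = y t + (-γ) • (c • (G.laplacian *ᵥ deviation (y t)) +
      (c * α) • h t) := by
    intro t
    ext i
    have h1 := congrFun (hdz_step t) i
    simp only [Pi.add_apply, Pi.smul_apply, smul_eq_mul] at h1
    simp only [hy, Pi.add_apply, Pi.sub_apply, Pi.smul_apply, smul_eq_mul, hζ, h1]
    rw [hLdz]
    -- The coefficient of `L dz` is `γ (c ^ 2 - β c + α β)`, which vanishes by the choice of `c`.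
    linear_combination (γ * (G.laplacian *ᵥ dz t) i) * hroot
  have hY_step : ∀ t, deviation (y (t + 1)) = deviation (y t) +
      (-γ) • (c • (G.laplacian *ᵥ deviation (y t)) + (c * α) • deviation (h t)) := by
    intro t
    have hs : ∑ i, y (t + 1) i = ∑ i, y t i - γ * (c * α) * ∑ i, h t i := by
      simp only [hy_step t, Pi.add_apply, Pi.smul_apply, smul_eq_mul, Finset.sum_add_distrib,
        ← Finset.mul_sum, hbal.sum_laplacian_mulVec]
      ring
    ext i
    have h1 := congrFun (hy_step t) i
    simp only [Pi.add_apply, Pi.smul_apply, smul_eq_mul] at h1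
    simp only [Pi.add_apply, Pi.smul_apply, smul_eq_mul]
    rw [show deviation (y (t + 1)) i = y (t + 1) i - (∑ j, y (t + 1) j) / N from rfl,
      show deviation (h t) i = h t i - (∑ j, h t j) / N from rfl, h1, hs]
    simp only [deviation]
    ring
  have hzh : ∀ t, l * (dz t ⬝ᵥ dz t) ≤ dz t ⬝ᵥ h t := by
    intro t
    simp only [dotProduct, Finset.mul_sum]
    refine Finset.sum_le_sum fun i _ => ?_
    have := hmono i (z t i) ystar
    rw [sq_abs] at this
    simp only [hdz, hh]
    linarith
  have hhh : ∀ t, h t ⬝ᵥ h t ≤ lbar ^ 2 * (dz t ⬝ᵥ dz t) := by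
    intro t
    simp only [dotProduct, Finset.mul_sum]
    refine Finset.sum_le_sum fun i _ => ?_
    have := pow_le_pow_left₀ (abs_nonneg _) (hlip i (z t i) ystar) 2
    rw [mul_pow, sq_abs, sq_abs] at this
    simp only [hdz, hh]
    linarith
  set κ := k / c with hκ
  have hκ0 : 0 < κ := by positivity
  have hκc : κ * c = k := by rw [hκ]; field_simp
  have hκc2 : κ * c ^ 2 = k * c := by rw [← hκc]; ring
  have hdec : ∀ t, κ * (deviation (y (t + 1)) ⬝ᵥ deviation (y (t + 1))) +
      dz (t + 1) ⬝ᵥ dz (t + 1) ≤ κ * (deviation (y t) ⬝ᵥ deviation (y t)) + dz t ⬝ᵥ dz t -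
        γ * (1 / 4 * (κ * c * lam2) * (deviation (y t) ⬝ᵥ deviation (y t)) +
          1 / 2 * (α * l) * (dz t ⬝ᵥ dz t)) := by
    intro t
    rw [hY_step, hdz_step]
    refine lyapunov_decrease hN hconn hbal hlam2 hlamN hα0 hγ hc hκ0 (by linarith) ?_ ?_ hk3 ?_ ?_
      (sum_deviation (by omega) _) (hzh t) (hhh t)
    · rw [hκc]; exact hk1
    · rw [mul_assoc 4 κ, hκc2, hκc, ← mul_assoc]; exact hk2
    · rw [mul_assoc 2 κ, hκc2, ← mul_assoc]; exact hk4
    · rw [hκc]; exact hk5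
  set V : ℕ → ℝ := fun t => κ * (deviation (y t) ⬝ᵥ deviation (y t)) + dz t ⬝ᵥ dz t with hV
  have hY0 : ∀ t, 0 ≤ deviation (y t) ⬝ᵥ deviation (y t) := fun t => dotProduct_self_nonneg _
  have hz0 : ∀ t, 0 ≤ dz t ⬝ᵥ dz t := fun t => dotProduct_self_nonneg _
  have hV0 : ∀ t, 0 ≤ V t := fun t => add_nonneg (mul_nonneg hκ0.le (hY0 t)) (hz0 t)
  -- The smaller of the two decay rates; the cap `1` keeps the contraction factor `1 - ε`
  -- nonnegative.
  set ε := min 1 (min (γ * (1 / 4 * (c * lam2))) (γ * (1 / 2 * (α * l)))) with hε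
  have hε0 : 0 < ε := lt_min one_pos (lt_min (by positivity) (by positivity))
  have hε1 : ε ≤ 1 := min_le_left _ _
  have hε2 : ε ≤ γ * (1 / 4 * (c * lam2)) := (min_le_right _ _).trans (min_le_left _ _)
  have hε3 : ε ≤ γ * (1 / 2 * (α * l)) := (min_le_right _ _).trans (min_le_right _ _)
  have hVlim : Tendsto V atTop (𝓝 0) := by
    refine tendsto_zero_of_le_mul (ρ := 1 - ε) hV0 (by linarith) (by linarith) fun t => ?_
    have h1 := hdec t
    have h2 := mul_le_mul_of_nonneg_right hε2 (mul_nonneg hκ0.le (hY0 t))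
    have h3 := mul_le_mul_of_nonneg_right hε3 (hz0 t)
    simp only [hV]
    linarith
  have hdzlim : Tendsto dz atTop (𝓝 0) :=
    tendsto_zero_of_dotProduct_self (squeeze_zero hz0
      (fun t => le_add_of_nonneg_left (mul_nonneg hκ0.le (hY0 t))) hVlim)
  have hYlim : Tendsto (fun t => deviation (y t)) atTop (𝓝 0) := by
    refine tendsto_zero_of_dotProduct_self (squeeze_zero hY0 (fun t => ?_)
      (by simpa using hVlim.const_mul κ⁻¹))
    rw [← div_eq_inv_mul, le_div_iff₀ hκ0]
    simp only [hV]
    linarith [hz0 t]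
  have hsum : ∀ t, ∑ i, ζ t i = ∑ i, ζ 0 i := by
    intro t
    induction t with
    | zero => rfl
    | succ t ih =>
      simp only [hζ, Finset.sum_add_distrib, ← Finset.mul_sum, hbal.sum_laplacian_mulVec,
        mul_zero, add_zero, ih]
  constructor
  · rw [tendsto_pi_nhds] at hdzlim ⊢
    intro i
    simpa [hdz] using (hdzlim i).add_const ystar
  -- The equilibria `ζs` form a line, and the conserved sum of `ζ` selects the one with the initial
  -- mean.
  · refine ⟨fun i => ζs i + (∑ j, (ζ 0 j - ζs j)) / N, ?_⟩
    rw [tendsto_pi_nhds] at hYlim hdzlim ⊢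
    intro i
    have hζeq : ∀ t, ζ t i = deviation (y t) i + ((∑ j, (ζ 0 j - ζs j)) +
        c * ∑ j, dz t j) / N + ζs i - c * dz t i := by
      intro t
      simp only [deviation, hy, Pi.add_apply, Pi.sub_apply, Pi.smul_apply, smul_eq_mul,
        Finset.sum_add_distrib, Finset.sum_sub_distrib, hsum t, ← Finset.mul_sum]
      ring
    have hsumlim : Tendsto (fun t => ∑ j, dz t j) atTop (𝓝 0) := by
      simpa using tendsto_finsetSum Finset.univ fun j _ => hdzlim j
    have hlim := (((hYlim i).add (((hsumlim.const_mul c).const_add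
      (∑ j, (ζ 0 j - ζs j))).div_const (N : ℝ))).add_const (ζs i)).sub ((hdzlim i).const_mul c)
    simp only [Pi.zero_apply, mul_zero, add_zero, zero_add, sub_zero] at hlim
    rw [add_comm (ζs i)]
    exact hlim.congr fun t => (hζeq t).symm

/-! ### The global minimizer -/

/-- Growth at rate `m` outweighs `|φ 0|` at distance `b` from the origin, so the intermediate value
theorem applies on `[-b, b]`; the `+ 1` in `b` only keeps it positive. -/
theorem exists_root_of_strongly_monotone {φ : ℝ → ℝ} (hφ : Continuous φ) {m : ℝ} (hm : 0 < m)
    (hmono : ∀ a b, m * |a - b| ^ 2 ≤ (φ a - φ b) * (a - b)) : ∃ s, φ s = 0 := by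
  set b := |φ 0| / m + 1 with hb
  have hb0 : 0 < b := by positivity
  have hmb : |φ 0| ≤ m * b := by
    rw [hb, mul_add, mul_div_cancel₀ _ hm.ne']
    linarith
  have h1 : 0 ≤ φ b := by
    have := hmono b 0
    rw [sq_abs, sub_zero] at this
    have h2 : m * b ≤ φ b - φ 0 := le_of_mul_le_mul_right (by linarith) hb0
    linarith [neg_abs_le (φ 0)]
  have h2 : φ (-b) ≤ 0 := by
    have := hmono 0 (-b)
    rw [sq_abs, zero_sub, neg_neg] at this
    have h2 : m * b ≤ φ 0 - φ (-b) := le_of_mul_le_mul_right (by linarith) hb0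
    linarith [le_abs_self (φ 0)]
  obtain ⟨s, -, hs⟩ := intermediate_value_Icc (by linarith : -b ≤ b) hφ.continuousOn ⟨h2, h1⟩
  exact ⟨s, hs⟩

theorem CostAssumption.le {l lbar : ℝ} {f : ℝ → ℝ} (h : CostAssumption l lbar f) : l ≤ lbar := by
  have h1 := h.2.2.1 1 0
  have h2 := h.2.2.2 1 0
  norm_num at h1 h2
  exact h1.trans ((le_abs_self _).trans h2)

theorem exists_isOptimalPoint {N : ℕ} (hN : 0 < N) {f : Fin N → ℝ → ℝ} {l lbar : ℝ}
    (hcost : ∀ i, CostAssumption l lbar (f i)) :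
    ∃ ystar, ∑ i, deriv (f i) ystar = 0 ∧ IsOptimalPoint f ystar := by
  have hl : 0 < l := (hcost ⟨0, hN⟩).1
  have hm : 0 < N * l := by positivity
  have hmono : ∀ a b, N * l * |a - b| ^ 2 ≤
      (∑ i, deriv (f i) a - ∑ i, deriv (f i) b) * (a - b) := by
    intro a b
    rw [← Finset.sum_sub_distrib, Finset.sum_mul]
    have := Finset.sum_le_sum fun i (_ : i ∈ Finset.univ) => (hcost i).2.2.1 a b
    rw [Finset.sum_const, Finset.card_univ, Fintype.card_fin, nsmul_eq_mul] at this
    linarith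
  have hcont : Continuous fun s => ∑ i, deriv (f i) s := by
    refine continuous_finsetSum _ fun i _ => ?_
    have hlbar : 0 ≤ lbar := hl.le.trans (hcost i).le
    exact (LipschitzWith.of_dist_le_mul (K := ⟨lbar, hlbar⟩) fun a b => by
      rw [Real.dist_eq, Real.dist_eq]
      exact (hcost i).2.2.2 a b).continuous
  obtain ⟨ystar, hstar⟩ := exists_root_of_strongly_monotone hcont hm hmono
  refine ⟨ystar, hstar, fun s hs => ?_⟩
  have hder : ∀ x, HasDerivAt (fun s => ∑ i, f i s) (∑ i, deriv (f i) x) x := fun x =>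
    HasDerivAt.fun_sum fun i _ => ((hcost i).2.1 x).hasDerivAt
  have hdiff : Differentiable ℝ fun s => ∑ i, f i s := fun x => (hder x).differentiableAt
  rcases lt_or_gt_of_ne hs with h | h
  · obtain ⟨ξ, hξ, he⟩ := exists_hasDerivAt_eq_slope (fun s => ∑ i, f i s) _ h
      hdiff.continuous.continuousOn fun x _ => hder x
    have h1 := hmono ystar ξ
    have h2 : 0 < N * l * |ystar - ξ| ^ 2 := by
      have : 0 < |ystar - ξ| := abs_pos.2 (by linarith [hξ.2])
      positivity
    rw [hstar, he, zero_sub] at h1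
    have h3 := (mul_pos_iff_of_pos_right (by linarith [hξ.2])).1 (h2.trans_le h1)
    rw [← neg_div, div_pos_iff_of_pos_right (by linarith)] at h3
    linarith
  · obtain ⟨ξ, hξ, he⟩ := exists_hasDerivAt_eq_slope (fun s => ∑ i, f i s) _ h
      hdiff.continuous.continuousOn fun x _ => hder x
    have h1 := hmono ξ ystar
    have h2 : 0 < N * l * |ξ - ystar| ^ 2 := by
      have : 0 < |ξ - ystar| := abs_pos.2 (by linarith [hξ.1])
      positivity
    rw [hstar, he, sub_zero] at h1
    have h3 := (mul_pos_iff_of_pos_right (by linarith [hξ.1])).1 (h2.trans_le h1)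
    rw [div_pos_iff_of_pos_right (by linarith)] at h3
    linarith

/-! ### Bounded trajectories -/

section Bounded

variable {m n : Type*} [Fintype m] [Fintype n]

theorem isBounded_range_add {V : Type*} [SeminormedAddCommGroup V] {u v : ℕ → V}
    (hu : Bornology.IsBounded (Set.range u)) (hv : Bornology.IsBounded (Set.range v)) :
    Bornology.IsBounded (Set.range fun t => u t + v t) := by
  refine (hu.add hv).subset ?_
  rintro _ ⟨t, rfl⟩
  exact Set.add_mem_add ⟨t, rfl⟩ ⟨t, rfl⟩

theorem isBounded_range_linearMap {V W : Type*} [NormedAddCommGroup V] [NormedSpace ℝ V]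
    [FiniteDimensional ℝ V] [NormedAddCommGroup W] [NormedSpace ℝ W] (g : V →ₗ[ℝ] W) {u : ℕ → V}
    (hu : Bornology.IsBounded (Set.range u)) :
    Bornology.IsBounded (Set.range fun t => g (u t)) := by
  have := g.toContinuousLinearMap.lipschitz.isBounded_image hu
  rwa [← Set.range_comp] at this

theorem isBounded_range_mulVec (A : Matrix m n ℝ) {u : ℕ → n → ℝ}
    (hu : Bornology.IsBounded (Set.range u)) :
    Bornology.IsBounded (Set.range fun t => A *ᵥ u t) :=
  isBounded_range_linearMap A.mulVecLin hu

theorem isBounded_range_prodMk {V W : Type*} [Bornology V] [Bornology W] {u : ℕ → V} {v : ℕ → W}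
    (hu : Bornology.IsBounded (Set.range u)) (hv : Bornology.IsBounded (Set.range v)) :
    Bornology.IsBounded (Set.range fun t => (u t, v t)) := by
  refine (hu.prod hv).subset ?_
  rintro _ ⟨t, rfl⟩
  exact ⟨⟨t, rfl⟩, ⟨t, rfl⟩⟩

theorem isBounded_range_pi {ι : Type*} [Fintype ι] {V : Type*} [PseudoMetricSpace V]
    {u : ℕ → ι → V} (hu : ∀ k, Bornology.IsBounded (Set.range fun t => u t k)) :
    Bornology.IsBounded (Set.range u) := by
  refine (Bornology.IsBounded.pi hu).subset ?_
  rintro _ ⟨t, rfl⟩ k _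
  exact ⟨t, rfl⟩

end Bounded

/-! ### Observability, boundedness of the disturbance states, and existence of the tuning parameters
-/

theorem IsObservable.eq_zero {n : Type*} [Fintype n] [DecidableEq n] {C : n → ℝ}
    {A : Matrix n n ℝ} (h : IsObservable C A) {v : n → ℝ}
    (hv : ∀ k < Fintype.card n, C ⬝ᵥ (A ^ k *ᵥ v) = 0) : v = 0 := by
  unfold IsObservable at h
  set T : Matrix (Fin (Fintype.card n)) n ℝ :=
    Matrix.of fun (k : Fin (Fintype.card n)) => C ᵥ* A ^ (k : ℕ) with hT
  have hsurj : Function.Surjective T.mulVecLin := by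
    rw [← LinearMap.range_eq_top]
    apply Submodule.eq_top_of_finrank_eq
    rw [Module.finrank_fintype_fun_eq_card, Fintype.card_fin]
    exact h
  have hinj : Function.Injective T.mulVecLin := by
    rw [LinearMap.injective_iff_surjective_of_finrank_eq_finrank (by simp)]
    exact hsurj
  apply hinj
  rw [map_zero, Matrix.mulVecLin_apply]
  ext k
  have := hv k k.2
  rwa [Matrix.dotProduct_mulVec] at this

namespace AgentModel

variable {nx nu nw : ℕ} {M : AgentModel nx nu nw}

/-- A disturbance state that never acts on the agent keeps the augmented state at `(0, S ^ k v)`,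
invisible to the output `[C 0]`. -/
theorem AugmentedObservable.eq_zero (hobs : M.AugmentedObservable) {v : Fin nw → ℝ}
    (hv : ∀ k < nx + nw, M.E *ᵥ (M.S ^ k *ᵥ v) = 0) : v = 0 := by
  have hpow : ∀ k ≤ nx + nw, Matrix.fromBlocks M.A M.E 0 M.S ^ k *ᵥ Sum.elim (0 : Fin nx → ℝ) v =
      Sum.elim (0 : Fin nx → ℝ) (M.S ^ k *ᵥ v) := by
    intro k
    induction k with
    | zero => simp
    | succ k ih =>
      intro hk
      rw [pow_succ', ← Matrix.mulVec_mulVec, ih (by omega), Matrix.fromBlocks_mulVec]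
      simp [hv k (by omega), pow_succ', Matrix.mulVec_mulVec]
  have h0 : (Sum.elim 0 v : Fin nx ⊕ Fin nw → ℝ) = 0 := by
    refine IsObservable.eq_zero hobs fun k hk => ?_
    rw [Fintype.card_sum, Fintype.card_fin, Fintype.card_fin] at hk
    rw [hpow k hk.le]
    simp [dotProduct]
  ext i
  exact congrFun h0 (Sum.inr i)

/-- The window `E w(t), …, E w(t + nx + nw - 1)` is an injective linear function of `w(t)`, so a
linear left inverse carries its bound over to `w`. -/
theorem AugmentedObservable.isBounded_disturbance_state (hobs : M.AugmentedObservable)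
    {w : ℕ → Fin nw → ℝ} (hw : ∀ t, w (t + 1) = M.S *ᵥ w t)
    (hb : Bornology.IsBounded (Set.range fun t => M.E *ᵥ w t)) :
    Bornology.IsBounded (Set.range w) := by
  let Φ : (Fin nw → ℝ) →ₗ[ℝ] (Fin (nx + nw) → Fin nx → ℝ) :=
    LinearMap.pi fun k => M.E.mulVecLin ∘ₗ (M.S ^ (k : ℕ)).mulVecLin
  have hker : LinearMap.ker Φ = ⊥ := by
    rw [LinearMap.ker_eq_bot']
    intro v hv
    exact hobs.eq_zero fun k hk => congrFun hv ⟨k, hk⟩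
  obtain ⟨g, hg⟩ := Φ.exists_leftInverse_of_injective hker
  have hshift : ∀ k t, w (t + k) = M.S ^ k *ᵥ w t := by
    intro k
    induction k with
    | zero => simp
    | succ k ih => intro t; rw [← add_assoc, hw, ih, Matrix.mulVec_mulVec, pow_succ']
  have hΦ : Bornology.IsBounded (Set.range fun t => Φ (w t)) := by
    refine isBounded_range_pi fun k => hb.subset ?_
    rintro _ ⟨t, rfl⟩
    refine ⟨t + k, ?_⟩
    simp [Φ, hshift, Matrix.mulVec_mulVec]
  have h := isBounded_range_linearMap g hΦ
  have heq : (fun t => g (Φ (w t))) = w := funext fun t => LinearMap.congr_fun hg (w t)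
  rwa [heq] at h

theorem AugmentedObservable.exists_observer_gains (hobs : M.AugmentedObservable) :
    ∃ (L₁ : Fin nx → ℝ) (L₂ : Fin nw → ℝ),
      IsSchur (Matrix.fromBlocks (M.A + vecMulVec L₁ M.C) M.E (vecMulVec L₂ M.C) M.S) := by
  obtain ⟨L, hL⟩ := IsObservable.exists_isSchur hobs
  refine ⟨fun i => L (Sum.inl i), fun i => L (Sum.inr i), ?_⟩
  convert hL using 1
  ext (i | i) (j | j) <;> simp [vecMulVec_apply]

end AgentModel

theorem exists_stepSizes {l lbar : ℝ} (hlbar : 0 < lbar) (lam2 lamN : ℝ) :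
    ∃ α β γ : ℝ, max 1 (max (1 / l) (2 * lbar ^ 2 / (l * lam2))) ≤ α ∧
      max 1 (4 * α ^ 2 * lamN ^ 2 / lam2 ^ 2) ≤ β ∧
      0 < γ ∧ γ < 1 / (β ^ 4 * (lamN ^ 2 + lbar ^ 2)) := by
  set α := max 1 (max (1 / l) (2 * lbar ^ 2 / (l * lam2)))
  set β := max 1 (4 * α ^ 2 * lamN ^ 2 / lam2 ^ 2)
  have hβ : 0 < β := one_pos.trans_le (le_max_left _ _)
  have hpos : 0 < 1 / (β ^ 4 * (lamN ^ 2 + lbar ^ 2)) := by positivity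
  exact ⟨α, β, _, le_rfl, le_rfl, half_pos hpos, half_lt_self hpos⟩

/-! ### The closed loop -/

section ClosedLoop

variable {N nx nu nw : ℕ} {M : AgentModel nx nu nw} {f : Fin N → ℝ → ℝ} {G : WeightedDigraph N}
  {X₁ : Fin nx → ℝ} {X₂ : Matrix (Fin nx) (Fin nw) ℝ} {U₁ : Fin nu → ℝ}
  {U₂ : Matrix (Fin nu) (Fin nw) ℝ} {g : Gains nx nu nw}

theorem WeightedDigraph.laplacian_mulVec_congr {i : Fin N} {x x' : Fin N → ℝ}
    (h : ∀ j, j = i ∨ G.Edge j i → x j = x' j) :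
    (G.laplacian *ᵥ x) i = (G.laplacian *ᵥ x') i := by
  rw [G.laplacian_mulVec_apply, G.laplacian_mulVec_apply]
  refine Finset.sum_congr rfl fun j _ => ?_
  rcases (G.weight_nonneg i j).eq_or_lt with h0 | h0
  · rw [← h0, zero_mul, zero_mul]
  · rw [h i (Or.inl rfl), h j (Or.inr h0)]

theorem fullController_isDistributed :
    (fullController M f G X₁ X₂ U₁ U₂ g).IsDistributed G := by
  intro i η η' y y' h
  obtain ⟨hη, hy⟩ := h i (Or.inl rfl)
  have h1 := G.laplacian_mulVec_congr (i := i) (x := fun j => (η j).z) (x' := fun j => (η' j).z)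
    fun j hj => by simp only [(h j hj).1]
  have h2 := G.laplacian_mulVec_congr (i := i) (x := fun j => (η j).lam) (x' := fun j => (η' j).lam)
    fun j hj => by simp only [(h j hj).1]
  simp only [fullController, hη, hy, h1, h2, and_self]

variable {x : ℕ → Fin N → Fin nx → ℝ} {w : ℕ → Fin N → Fin nw → ℝ}
  {η : ℕ → Fin N → CtrlState nx nw}

/-- The input enters plant and observer alike and cancels, so the joint error follows the block
matrix of the design condition with no forcing. -/
theorem observer_error_tendsto [Nonempty (Fin nx)] (hg : g.StabilizingFor M)
    (htraj : IsClosedLoopTrajectory M (fullController M f G X₁ X₂ U₁ U₂ g) x w η) (i : Fin N) :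
    Tendsto (fun t => (η t i).xhat - x t i) atTop (𝓝 0) ∧
      Tendsto (fun t => (η t i).what - w t i) atTop (𝓝 0) := by
  have h := hg.2.tendsto_zero (r := 0)
    (e := fun t => Sum.elim ((η t i).xhat - x t i) ((η t i).what - w t i)) tendsto_const_nhds
    (fun t => by
      have hx := htraj.state t i
      have hw := htraj.disturbance t i
      have hη := htraj.controller t i
      have h1 : (η (t + 1) i).xhat = _ := congrArg (fun c : CtrlState nx nw => c.xhat) hη
      have h2 : (η (t + 1) i).what = _ := congrArg (fun c : CtrlState nx nw => c.what) hη
      rw [h1, h2, hx, hw, Pi.zero_apply, add_zero, Matrix.fromBlocks_mulVec]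
      simp only [fullController, CtrlState.xhat, CtrlState.what, outputs, Sum.elim_comp_inl,
        Sum.elim_comp_inr, Matrix.add_mulVec, Matrix.mulVec_sub, Matrix.vecMulVec_mulVec,
        op_smul_eq_smul, sub_smul]
      congr 1 <;> abel)
  rw [tendsto_pi_nhds] at h
  constructor
  · rw [tendsto_pi_nhds]
    exact fun k => h (Sum.inl k)
  · rw [tendsto_pi_nhds]
    exact fun k => h (Sum.inr k)

/-- The regulator equations make `z • X₁ + X₂ *ᵥ w` invariant for frozen `z` and exact estimates.
What remains is `A + B K` forced by the drift of `z` and the observer errors. -/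
theorem tracking_error_tendsto [Nonempty (Fin nx)] (hreg : M.RegulatorEquations X₁ X₂ U₁ U₂)
    (hg : g.StabilizingFor M)
    (htraj : IsClosedLoopTrajectory M (fullController M f G X₁ X₂ U₁ U₂ g) x w η) {i : Fin N}
    {zlim : ℝ} (hz : Tendsto (fun t => (η t i).z) atTop (𝓝 zlim)) :
    Tendsto (fun t => x t i - (η t i).z • X₁ - X₂ *ᵥ w t i) atTop (𝓝 0) := by
  obtain ⟨hex, hew⟩ := observer_error_tendsto hg htraj i
  obtain ⟨hX₁, -, hX₂, -⟩ := hreg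
  refine hg.1.tendsto_zero (r := fun t => ((η t i).z - (η (t + 1) i).z) • X₁ +
    M.B *ᵥ (g.K *ᵥ ((η t i).xhat - x t i) + (U₂ - g.K * X₂) *ᵥ ((η t i).what - w t i))) ?_ ?_
  · have h1 : Tendsto (fun t => ((η t i).z - (η (t + 1) i).z) • X₁) atTop (𝓝 0) := by
      simpa using (hz.sub (hz.comp (tendsto_add_atTop_nat 1))).smul_const X₁
    have h2 := tendsto_mulVec_zero M.B (by
      simpa using (tendsto_mulVec_zero g.K hex).add (tendsto_mulVec_zero (U₂ - g.K * X₂) hew))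
    simpa using h1.add h2
  · intro t
    have h2 : X₂ *ᵥ (M.S *ᵥ w t i) =
        M.A *ᵥ (X₂ *ᵥ w t i) + M.B *ᵥ (U₂ *ᵥ w t i) + M.E *ᵥ w t i := by
      rw [Matrix.mulVec_mulVec, hX₂]
      simp only [Matrix.add_mulVec, Matrix.mulVec_mulVec]
    rw [htraj.state, htraj.disturbance, h2]
    simp only [fullController, fullInput, Matrix.add_mulVec, Matrix.sub_mulVec, Matrix.mulVec_add,
      Matrix.mulVec_sub, Matrix.mulVec_smul, ← Matrix.mulVec_mulVec]
    ext k
    have h3 := congrFun hX₁ k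
    simp only [Pi.add_apply, Pi.sub_apply, Pi.smul_apply, smul_eq_mul] at h3 ⊢
    linear_combination (-(η t i).z) * h3

theorem isBounded_closedLoop [Nonempty (Fin nx)] (hreg : M.RegulatorEquations X₁ X₂ U₁ U₂)
    (hobs : M.AugmentedObservable) (hg : g.StabilizingFor M)
    (htraj : IsClosedLoopTrajectory M (fullController M f G X₁ X₂ U₁ U₂ g) x w η) {i : Fin N}
    {zlim lamlim : ℝ} (hz : Tendsto (fun t => (η t i).z) atTop (𝓝 zlim))
    (hlam : Tendsto (fun t => (η t i).lam) atTop (𝓝 lamlim))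
    (hd : Bornology.IsBounded (Set.range fun t => M.E *ᵥ w t i)) :
    Bornology.IsBounded (Set.range fun t => x t i) ∧
      Bornology.IsBounded (Set.range fun t => fullInput g.K X₁ X₂ U₁ U₂ (η t i)) ∧
      Bornology.IsBounded (Set.range fun t => η t i) := by
  obtain ⟨hex, hew⟩ := observer_error_tendsto hg htraj i
  have htrack := tracking_error_tendsto hreg hg htraj hz
  have hwb : Bornology.IsBounded (Set.range fun t => w t i) :=
    hobs.isBounded_disturbance_state (fun t => htraj.disturbance t i) hd
  have hzb := Metric.isBounded_range_of_tendsto _ hz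
  have hlamb := Metric.isBounded_range_of_tendsto _ hlam
  have hzv : ∀ {p : ℕ} (v : Fin p → ℝ),
      Bornology.IsBounded (Set.range fun t => (η t i).z • v) := fun v =>
    Metric.isBounded_range_of_tendsto _ (hz.smul_const v)
  have hxb : Bornology.IsBounded (Set.range fun t => x t i) := by
    have := isBounded_range_add (Metric.isBounded_range_of_tendsto _ htrack)
      (isBounded_range_add (hzv X₁) (isBounded_range_mulVec X₂ hwb))
    refine this.subset ?_
    rintro _ ⟨t, rfl⟩
    exact ⟨t, by dsimp only; abel⟩
  have hxhb : Bornology.IsBounded (Set.range fun t => (η t i).xhat) := by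
    simpa using isBounded_range_add (Metric.isBounded_range_of_tendsto _ hex) hxb
  have hwhb : Bornology.IsBounded (Set.range fun t => (η t i).what) := by
    simpa using isBounded_range_add (Metric.isBounded_range_of_tendsto _ hew) hwb
  exact ⟨hxb, isBounded_range_add (isBounded_range_add (isBounded_range_mulVec g.K hxhb) (hzv _))
    (isBounded_range_mulVec _ hwhb), isBounded_range_prodMk hxhb
      (isBounded_range_prodMk hwhb (isBounded_range_prodMk hzb hlamb))⟩

end ClosedLoop

end OptimalConsensus

end

/-! ### The main theorem -/

theorem theorem1 {N nx nu nw : ℕ} (hN : 2 ≤ N)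
    (M : OptimalConsensus.AgentModel nx nu nw) (hmin : M.IsMinimal)
    (f : Fin N → ℝ → ℝ) (l lbar : ℝ)
    (hcost : ∀ i, OptimalConsensus.CostAssumption l lbar (f i))
    (G : OptimalConsensus.WeightedDigraph N)
    (hconn : G.StronglyConnected) (hbal : G.WeightBalanced)
    (X₁ : Fin nx → ℝ) (X₂ : Matrix (Fin nx) (Fin nw) ℝ)
    (U₁ : Fin nu → ℝ) (U₂ : Matrix (Fin nu) (Fin nw) ℝ)
    (hreg : M.RegulatorEquations X₁ X₂ U₁ U₂)
    (hobs : M.AugmentedObservable) :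
    (∃ g : OptimalConsensus.Gains nx nu nw, g.StabilizingFor M ∧
      g.StepSizesFor l lbar (G.eigenvalue ⟨1, by omega⟩) (G.eigenvalue ⟨N - 1, by omega⟩)) ∧
    ∀ g : OptimalConsensus.Gains nx nu nw, g.StabilizingFor M →
      g.StepSizesFor l lbar (G.eigenvalue ⟨1, by omega⟩) (G.eigenvalue ⟨N - 1, by omega⟩) →
      OptimalConsensus.SolvesOptimalOutputConsensus M f G
        (OptimalConsensus.fullController M f G X₁ X₂ U₁ U₂ g) := by
  have hl : 0 < l := (hcost ⟨0, by omega⟩).1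
  have hlbar : l ≤ lbar := (hcost ⟨0, by omega⟩).le
  have hlbar0 : 0 < lbar := hl.trans_le hlbar
  have hlam2 := hconn.eigenvalue_one_pos hbal hN
  constructor
  · obtain ⟨K, hK⟩ := hmin.1.exists_isSchur
    obtain ⟨L₁, L₂, hL⟩ := hobs.exists_observer_gains
    obtain ⟨α, β, γ, hα, hβ, hγ, hγ'⟩ := OptimalConsensus.exists_stepSizes (l := l) hlbar0
      (G.eigenvalue ⟨1, hN⟩) (G.eigenvalue ⟨N - 1, Nat.sub_one_lt_of_lt hN⟩)
    exact ⟨⟨K, L₁, L₂, α, β, γ⟩, ⟨hK, hL⟩, hα, hβ, hγ, hγ'⟩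
  · intro g hg hstep
    refine ⟨OptimalConsensus.fullController_isDistributed, ?_⟩
    obtain ⟨ystar, hstar, hopt⟩ := OptimalConsensus.exists_isOptimalPoint (by omega) hcost
    refine ⟨ystar, hopt, fun x w η htraj => ?_⟩
    -- The equation `1 = C X₁` rules out an empty state space.
    have hne : Nonempty (Fin nx) := by
      by_contra hempty
      rw [not_nonempty_iff] at hempty
      have := hreg.2.1
      simp at this
    obtain ⟨hα, hβ, hγ, hγ'⟩ := hstep
    simp only [max_le_iff] at hα hβ
    obtain ⟨hα1, hαl, hαlam⟩ := hα
    obtain ⟨hβ1, hβ⟩ := hβ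
    rw [div_le_iff₀ hl] at hαl
    rw [div_le_iff₀ (by positivity), ← mul_assoc] at hαlam
    rw [div_le_iff₀ (by positivity)] at hβ
    rw [lt_div_iff₀ (by positivity)] at hγ'
    obtain ⟨hz, lamlim, hlam⟩ := OptimalConsensus.optimalSignalGenerator_tendsto hN hconn hbal
      rfl rfl hl hlbar hα1 hαl hαlam hβ hγ hγ'.le (φ := fun i => deriv (f i))
      (fun i => (hcost i).2.2.1) (fun i => (hcost i).2.2.2) hstar
      (z := fun t i => (η t i).z) (ζ := fun t i => (η t i).lam)
      (fun t i => congrArg (fun c : OptimalConsensus.CtrlState nx nw => c.z)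
        (htraj.controller t i))
      (fun t i => congrArg (fun c : OptimalConsensus.CtrlState nx nw => c.lam)
        (htraj.controller t i))
    rw [tendsto_pi_nhds] at hz hlam
    refine ⟨fun i => ?_, fun i hd =>
      OptimalConsensus.isBounded_closedLoop hreg hobs hg htraj (hz i) (hlam i) hd⟩
    have htrack := OptimalConsensus.tracking_error_tendsto hreg hg htraj (hz i)
    have hlim := (((Continuous.dotProduct (continuous_const (y := M.C)) continuous_id).tendsto
      0).comp htrack).add ((hz i).sub_const ystar)
    -- `C` turns `z • X₁` into `z` and annihilates `X₂ *ᵥ w`, so no bound on `w` is needed.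
    have hout : ∀ t, OptimalConsensus.outputs M (x t) i - ystar =
        M.C ⬝ᵥ (x t i - (η t i).z • X₁ - X₂ *ᵥ w t i) + ((η t i).z - ystar) := by
      intro t
      obtain ⟨-, h1, -, h2⟩ := hreg
      rw [dotProduct_sub, dotProduct_sub, dotProduct_smul, ← h1, Matrix.dotProduct_mulVec, ← h2,
        zero_dotProduct, smul_eq_mul, OptimalConsensus.outputs]
      ring
    have hlim' := hlim.abs
    simp only [id, dotProduct_zero, sub_self, add_zero, abs_zero] at hlim'
    exact hlim'.congr fun t => by rw [hout]; rfl
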